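/- Let $n\ge 2$, let $\mathbb{H}^n$ be the open unit ball of $\mathbb{R}^n$ with the hyperbolic metric $\big(\frac{2}{1-|x|^2}\big)^2(dx_1^2+\cdots+dx_n^2)$, and give $\mathbb{H}^n\times\mathbb{R}$ the product metric. For $a>0$ the Cauchy problem $$f''=(n-1)\coth(f)\,(1+f'^2),\qquad f(0)=a,\qquad f'(0)=0$$ (for positive functions $f$ on open intervals containing $0$) has a unique maximal solution $(I_a,f(a,\cdot))$. The curve $C_a=\{(\tanh(f(a,t)/2),t): t\in I_a\}$ (catenary) in the vertical plane with coordinates $(x_n,t)$ generates, by rotation about the axis $\{0\}\times\mathbb{R}$, a complete minimal smoothly immersed rotation hypersurface $\mathcal{C}_a$ (catenoid), parametrized by $I_a\times S^{n-1}\ni(t,\xi)\mapsto(\tanh(f(a,t)/2)\,\xi,\,t)\in\mathbb{H}^n\times\mathbb{R}$. Moreover: 1. $I_a=\,]-T(a),T(a)[$ for some finite $T(a)>0$, and $f(a,\cdot)$ is even. 2. $f(a,t)\ge a$ for all $t\in I_a$. 3. $f_t(a,\cdot)$ is positive on $]0,T(a)[$ and negative on $]-T(a),0[$. 4. $f(a,\cdot)$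 is a bijection from $[0,T(a)[$ onto $[a,\infty[$, with inverse function $$\lambda(a,\rho)=\sinh^{n-1}(a)\int_a^\rho\big(\sinh^{2n-2}(u)-\sinh^{2n-2}(a)\big)^{-1/2}\,du ,$$ the integral being convergent for every $\rho\ge a$. 5. The vertical height $h_R(a)$ of $\mathcal{C}_a$ (the length of the projection of $\mathcal{C}_a$ to the $\mathbb{R}$ factor) is finite and $$h_R(a)=2\sinh^{n-1}(a)\int_a^\infty\big(\sinh^{2n-2}(u)-\sinh^{2n-2}(a)\big)^{-1/2}\,du ,$$ with a convergent integral. 6. The function $a\mapsto h_R(a)$ is strictly increasing on $]0,\infty[$, with $h_R(a)\to 0$ as $a\to 0^+$ and $h_R(a)\to\frac{\pi}{n-1}$ as $a\to\infty$. Furthermore, for $a,b>0$ with $a\ne b$, the catenaries $C_a$ and $C_b$ meet in exactly two points, and these are of the form $(x,t)$ and $(x,-t)$ with $t>0$. -/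

import Mathlib

open Set Filter Topology MeasureTheory Manifold
open scoped ContDiff ENNReal

/-! ## Hypersurfaces immersed in an open set of a vector space with a Riemannian metric

A metric on (an open subset of) the vector space `F` is given as `g : F → F → F → ℝ`, where
`g p v w` is the scalar product of the tangent vectors `v`, `w` at the point `p`. -/

noncomputable section Hypersurface

variable {F : Type*} [NormedAddCommGroup F] [NormedSpace ℝ F]

/-- Christoffel symbol of the first kind of the Levi-Civita connection of `g` :
`g p (Γ_p(u, v)) w = (1/2) (D_u g (v, w) + D_v g (u, w) - D_w g (u, v))`. -/
def christoffelFirst (g : F → F → F → ℝ) (p u v w : F) : ℝ :=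
  (1 / 2) * (fderiv ℝ (fun q => g q v w) p u + fderiv ℝ (fun q => g q u w) p v
    - fderiv ℝ (fun q => g q u v) p w)

/-- For a local parametrization `φ` of a submanifold, the number `g (∇_u (dφ v), ν)` at the
parameter `y`. When `ν` is normal to `φ` at `y`, this is the second fundamental form in the
direction `ν`, evaluated on `(u, v)`. -/
def secondFundForm {W : Type*} [NormedAddCommGroup W] [NormedSpace ℝ W]
    (g : F → F → F → ℝ) (φ : W → F) (y : W) (ν : F) (u v : W) : ℝ :=
  g (φ y) (fderiv ℝ (fun z => fderiv ℝ φ z v) y u) ν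
    + christoffelFirst g (φ y) (fderiv ℝ φ y u) (fderiv ℝ φ y v) ν

variable {W : Type*} [NormedAddCommGroup W] [NormedSpace ℝ W]
  {H : Type*} [TopologicalSpace H] (J : ModelWithCorners ℝ W H)
  {M : Type*} [TopologicalSpace M] [ChartedSpace H M]

/-- `X` is a smooth immersion of the manifold `M`, with values in the open set `U`. -/
def IsSmoothImmersionInto (U : Set F) (X : M → F) : Prop :=
  (∀ p, X p ∈ U) ∧ ContMDiff J 𝓘(ℝ, F) ∞ X ∧
    ∀ p, Function.Injective (mfderiv J 𝓘(ℝ, F) X p)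

/-- The mean curvature vector of the local parametrization `φ` vanishes at the parameter `y`: for
every normal vector `ν`, the trace with respect to the induced metric (computed in any orthonormal
basis `dφ e₁, dφ e₂, …` of the tangent space) of the second fundamental form in the direction `ν` is
zero. -/
def ZeroMeanCurvatureAt (g : F → F → F → ℝ) (φ : W → F) (y : W) : Prop :=
  ∀ (ν : F) (e : Fin (Module.finrank ℝ W) → W),
    (∀ v, g (φ y) (fderiv ℝ φ y v) ν = 0) →
    (∀ i j, g (φ y) (fderiv ℝ φ y (e i)) (fderiv ℝ φ y (e j)) = if i = j then 1 else 0) →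
    ∑ i, secondFundForm g φ y ν (e i) (e i) = 0

/-- The immersion `X` of the (boundaryless) manifold `M` is minimal: at every point, in the
preferred chart there, the mean curvature vector vanishes. -/
def HasZeroMeanCurvature (g : F → F → F → ℝ) (X : M → F) : Prop :=
  ∀ p : M, ZeroMeanCurvatureAt g (X ∘ (extChartAt J p).symm) (extChartAt J p p)

/-- The distance on `M` associated with the metric induced by `X`: infimum of the lengths of
`C^1` paths. -/
def inducedEDist (g : F → F → F → ℝ) (X : M → F) (p q : M) : ℝ≥0∞ :=
  letI : ∀ x : M, ENorm (TangentSpace J x) := fun x =>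
    ⟨fun v => ENNReal.ofReal
      (√(g (X x) (mfderiv J 𝓘(ℝ, F) X x v) (mfderiv J 𝓘(ℝ, F) X x v)))⟩
  Manifold.riemannianEDist J p q

/-- The metric induced by `X` on `M` is complete: every Cauchy sequence for the induced Riemannian
distance converges in `M`. -/
def IsCompleteFor (g : F → F → F → ℝ) (X : M → F) : Prop :=
  ∀ u : ℕ → M,
    (∀ ε : ℝ≥0∞, 0 < ε → ∃ N, ∀ k ≥ N, ∀ l ≥ N, inducedEDist J g X (u k) (u l) < ε) →
    ∃ p, Tendsto u atTop (𝓝 p)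

end Hypersurface

/-! ## The product of hyperbolic space (ball model) with the line, and rotation hypersurfaces -/

noncomputable section HyperbolicProduct

/-- The vector space containing the ball model of `ℍⁿ × ℝ`. -/
abbrev Ambient (n : ℕ) : Type := EuclideanSpace ℝ (Fin n) × ℝ

/-- `ℍⁿ × ℝ`, where `ℍⁿ` is the open unit ball. -/
def hypProd (n : ℕ) : Set (Ambient n) := {p | ‖p.1‖ < 1}

/-- The product metric `(2 / (1 - |x|²))² (dx₁² + ⋯ + dxₙ²) + dt²`. -/
def hypProdMetric (n : ℕ) (p v w : Ambient n) : ℝ :=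
  (2 / (1 - ‖p.1‖ ^ 2)) ^ 2 * inner ℝ v.1 w.1 + v.2 * w.2

/-- The unit sphere `S^{n-1}`. -/
abbrev UnitSphere (n : ℕ) : Type := Metric.sphere (0 : EuclideanSpace ℝ (Fin n)) 1

instance factFinrankEuclidean (n : ℕ) [h : Fact (2 ≤ n)] :
    Fact (Module.finrank ℝ (EuclideanSpace ℝ (Fin n)) = (n - 1) + 1) :=
  ⟨by have := h.out; rw [finrank_euclideanSpace_fin]; omega⟩

/-- The model with corners of the `n`-manifold `I × S^{n-1}`, `I` an open subset of `ℝ`. -/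
abbrev cylinderModel (n : ℕ) :
    ModelWithCorners ℝ (ℝ × EuclideanSpace ℝ (Fin (n - 1)))
      (ModelProd ℝ (EuclideanSpace ℝ (Fin (n - 1)))) :=
  (𝓘(ℝ, ℝ)).prod (𝓡 (n - 1))

/-- The rotation hypersurface about `{0} × ℝ` whose point at height `t` in the direction `ξ` is at
hyperbolic distance `f t` from the axis. -/
def rotationParam (n : ℕ) (I : TopologicalSpace.Opens ℝ) (f : ℝ → ℝ) :
    I × UnitSphere n → Ambient n :=
  fun p => (Real.tanh (f p.1 / 2) • (p.2 : EuclideanSpace ℝ (Fin n)), (p.1 : ℝ))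

/-- The generating curve of the rotation hypersurface, in the coordinates `(xₙ, t)` of the vertical
plane `x₁ = ⋯ = xₙ₋₁ = 0`. -/
def generatingCurve (I : TopologicalSpace.Opens ℝ) (f : ℝ → ℝ) : Set (ℝ × ℝ) :=
  (fun t => (Real.tanh (f t / 2), t)) '' (I : Set ℝ)

/-- The vertical height (possibly infinite) of a subset of `ℍⁿ × ℝ`: the diameter of its projection
to the vertical axis. -/
def verticalHeight {n : ℕ} (S : Set (Ambient n)) : ℝ≥0∞ := Metric.ediam (Prod.snd '' S)

/-- The vertical height (a real number, when finite) of the rotation hypersurface of profile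
`f`. -/
def rotationHeight (n : ℕ) (I : TopologicalSpace.Opens ℝ) (f : ℝ → ℝ) : ℝ :=
  (verticalHeight (range (rotationParam n I f))).toReal

end HyperbolicProduct

/-! ## The Cauchy problem -/

noncomputable section Catenary

/-- `f` is on the open interval `I ∋ 0` a (positive) solution of
`f'' = (n - 1) coth f (1 + f'²)`, `f 0 = a`, `f' 0 = 0`. The values of `f` outside `I` are
irrelevant. -/
structure IsCatenarySolution (n : ℕ) (a : ℝ) (I : TopologicalSpace.Opens ℝ) (f : ℝ → ℝ) :
    Prop where
  ordConnected : (I : Set ℝ).OrdConnected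
  zero_mem : (0 : ℝ) ∈ I
  pos : ∀ t ∈ I, 0 < f t
  differentiableAt : ∀ t ∈ I, DifferentiableAt ℝ f t
  ode : ∀ t ∈ I, HasDerivAt (deriv f)
    (((n : ℝ) - 1) * (Real.cosh (f t) / Real.sinh (f t)) * (1 + deriv f t ^ 2)) t
  init : f 0 = a
  deriv_init : deriv f 0 = 0

/-- A maximal solution: one that has no extension to a strictly larger open interval. -/
structure IsMaximalCatenarySolution (n : ℕ) (a : ℝ) (I : TopologicalSpace.Opens ℝ) (f : ℝ → ℝ) :
    Prop extends IsCatenarySolution n a I f where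
  maximal : ∀ (I' : TopologicalSpace.Opens ℝ) (f' : ℝ → ℝ), IsCatenarySolution n a I' f' →
    I ≤ I' → EqOn f' f I → I' = I

/-- The integrand `(sinh^{2n-2} u - sinh^{2n-2} a)^{-1/2}`. -/
def catenaryIntegrand (n : ℕ) (a u : ℝ) : ℝ :=
  (Real.sinh u ^ (2 * n - 2) - Real.sinh a ^ (2 * n - 2)) ^ (-(1 / 2) : ℝ)

/-- `λ(a, ρ) = sinh^{n-1} a ∫_a^ρ (sinh^{2n-2} u - sinh^{2n-2} a)^{-1/2} du`. -/
def catenaryInverse (n : ℕ) (a ρ : ℝ) : ℝ :=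
  Real.sinh a ^ (n - 1) * ∫ u in a..ρ, catenaryIntegrand n a u

end Catenary

/-!
The whole statement follows from an explicit description of the catenary by the parameter `w` with
`f' = sinh w`. The equation has the first integral `1 + f'² = (sinh f / sinh a)^{2(n-1)}`, so that
`f = catRadius w` is a smooth function of `w`, and `w` obeys the autonomous equation
`dw/dt = (n-1) coth f cosh w`, whose right-hand side is positive. Hence `t = catTime w` is the
integral of a smooth positive function `catSpeed`, a diffeomorphism from `ℝ` onto `]-T, T[` with
`T = catHalf` finite, and the solution is `catRadius ∘ catTime⁻¹`. The same two steps, applied to an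
arbitrary solution, show that it is a restriction of this one
(`IsCatenarySolution.eq_catProfile`), which gives uniqueness and maximality. Evenness, monotonicity
and properness are read off from the formulas.

The singular integrals of the statement are obtained from `w` by the substitution
`cosh w = (sinh ρ / sinh a)^{n-1}` (`invTime`): the integrand is the derivative of a function
that is continuous up to the end point. The height is `2 T`, with
`T = (n-1)⁻¹ ∫_0^∞ tanh (catRadius w) / cosh w dw`. The integrand increases with `a`, tends to `0`
as `a → 0` and to `1 / cosh w` as `a → ∞`, and is dominated by `1 / cosh w`, of integral `π / 2`.
For `a < b`, the difference of the inverse functions of the two profiles is strictly increasing on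
`[b, ∞[`, negative at `b`, and positive at infinity by the monotonicity of the height: this gives
the unique crossing in the upper half plane.

Minimality is a computation in the charts of the sphere (`zeroMeanCurvatureAt_rotationLocal`).
Completeness holds since the height, the ball component and the hyperbolic distance to the axis are
1-Lipschitz for the induced distance, while the distance to the axis, which is `f`, tends to
infinity at the ends of the interval.
-/

/-! ### The hyperbolic tangent -/

noncomputable section Hyperbolic

lemma hasDerivAt_tanh (x : ℝ) : HasDerivAt Real.tanh (1 - Real.tanh x ^ 2) x := by
  have hc := (Real.cosh_pos x).ne'
  rw [show Real.tanh = fun x => Real.sinh x / Real.cosh x from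
    funext Real.tanh_eq_sinh_div_cosh]
  refine ((Real.hasDerivAt_sinh x).div (Real.hasDerivAt_cosh x) hc).congr_deriv ?_
  field_simp

lemma contDiff_tanh : ContDiff ℝ ∞ Real.tanh := by
  rw [show Real.tanh = fun x => Real.sinh x / Real.cosh x from
    funext Real.tanh_eq_sinh_div_cosh]
  exact Real.contDiff_sinh.div Real.contDiff_cosh fun x => (Real.cosh_pos x).ne'

lemma strictMono_tanh : StrictMono Real.tanh :=
  strictMono_of_hasDerivAt_pos hasDerivAt_tanh fun x => by
    nlinarith [Real.tanh_lt_one x, Real.neg_one_lt_tanh x]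

lemma tendsto_tanh_atTop : Tendsto Real.tanh atTop (𝓝 1) := by
  refine tendsto_order.2 ⟨fun c hc => ?_, fun c hc =>
    Eventually.of_forall fun x => (Real.tanh_lt_one x).trans hc⟩
  filter_upwards [eventually_gt_atTop (Real.artanh (max c 0))] with x hx
  have h := strictMono_tanh hx
  rw [Real.tanh_artanh ⟨by linarith [le_max_right c 0], max_lt hc one_pos⟩] at h
  exact (le_max_left c 0).trans_lt h

end Hyperbolic

/-! ### The catenary, parametrized by its slope -/

noncomputable section Profile

/-- The radius `f` expressed through the slope parameter `w`, defined by `f' = sinh w`: the first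
integral `1 + f'² = (sinh f / sinh a)^{2m}` reads `sinh f = sinh a (cosh w)^{1/m}`.
Here and below `m = n - 1`. -/
def catRadius (m : ℕ) (a w : ℝ) : ℝ :=
  Real.arsinh (Real.sinh a * Real.cosh w ^ (1 / (m : ℝ)))

/-- The speed `dt/dw` of the height with respect to the slope parameter `w`; the equation
`f'' = m coth f (1 + f'²)` becomes `dw/dt = m coth f cosh w`. -/
def catSpeed (m : ℕ) (a w : ℝ) : ℝ :=
  Real.tanh (catRadius m a w) / (m * Real.cosh w)

/-- The height at which the catenary has slope parameter `w`. -/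
def catTime (m : ℕ) (a w : ℝ) : ℝ := ∫ x in (0 : ℝ)..w, catSpeed m a x

/-- Half of the height of the catenoid: the height gained while the slope parameter goes from `0`
to `∞`. -/
def catHalf (m : ℕ) (a : ℝ) : ℝ := ∫ x in Ioi (0 : ℝ), catSpeed m a x

variable {m : ℕ} {a b : ℝ}

lemma sinh_catRadius (m : ℕ) (a w : ℝ) :
    Real.sinh (catRadius m a w) = Real.sinh a * Real.cosh w ^ (1 / (m : ℝ)) :=
  Real.sinh_arsinh _

lemma sinh_catRadius_pow (hm : 0 < m) (a w : ℝ) :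
    Real.sinh (catRadius m a w) ^ m = Real.sinh a ^ m * Real.cosh w := by
  rw [sinh_catRadius, mul_pow, one_div, Real.rpow_inv_natCast_pow (Real.cosh_pos w).le hm.ne']

lemma catRadius_zero (m : ℕ) (a : ℝ) : catRadius m a 0 = a := by
  simp [catRadius]

lemma catRadius_neg (m : ℕ) (a w : ℝ) : catRadius m a (-w) = catRadius m a w := by
  simp [catRadius]

lemma le_catRadius (ha : 0 < a) (w : ℝ) : a ≤ catRadius m a w := by
  rw [← Real.sinh_le_sinh, sinh_catRadius]
  exact le_mul_of_one_le_right (Real.sinh_pos_iff.2 ha).le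
    (Real.one_le_rpow (Real.one_le_cosh w) (by positivity))

lemma catRadius_pos (ha : 0 < a) (w : ℝ) : 0 < catRadius m a w := ha.trans_le (le_catRadius ha w)

/-- The radius is determined by the slope through the first integral. -/
lemma eq_catRadius (hm : 0 < m) (ha : 0 < a) {ρ w : ℝ} (hρ : 0 < ρ)
    (h : Real.sinh ρ ^ m = Real.sinh a ^ m * Real.cosh w) : ρ = catRadius m a w := by
  rw [← Real.sinh_inj]
  refine (pow_left_inj₀ (Real.sinh_pos_iff.2 hρ).le
    (Real.sinh_pos_iff.2 (catRadius_pos ha w)).le hm.ne').1 ?_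
  rw [h, sinh_catRadius_pow hm]

lemma contDiff_catRadius (m : ℕ) (a : ℝ) : ContDiff ℝ ∞ (catRadius m a) := by
  unfold catRadius
  refine Real.contDiff_arsinh.comp (contDiff_const.mul ?_)
  exact Real.contDiff_cosh.rpow_const_of_ne fun w => (Real.cosh_pos w).ne'

lemma contDiff_catSpeed (hm : 0 < m) (a : ℝ) : ContDiff ℝ ∞ (catSpeed m a) := by
  have h : catSpeed m a = fun w => Real.sinh (catRadius m a w) / Real.cosh (catRadius m a w) /
      (m * Real.cosh w) := by
    funext w; rw [catSpeed, Real.tanh_eq_sinh_div_cosh]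
  rw [h]
  have hR := contDiff_catRadius m a
  refine (hR.sinh.div hR.cosh fun w => (Real.cosh_pos _).ne').div
    (contDiff_const.mul Real.contDiff_cosh) fun w => ?_
  have := Real.cosh_pos w
  positivity

lemma hasDerivAt_catRadius (m : ℕ) (a w : ℝ) :
    HasDerivAt (catRadius m a) (Real.sinh w * catSpeed m a w) w := by
  have hc := Real.cosh_pos w
  have h1 := ((Real.hasDerivAt_cosh w).rpow_const (p := 1 / (m : ℝ)) (Or.inl hc.ne')).const_mul
    (Real.sinh a)
  have h2 := (Real.hasDerivAt_arsinh _).comp w h1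
  refine h2.congr_deriv ?_
  have h3 : √(1 + (Real.sinh a * Real.cosh w ^ (1 / (m : ℝ))) ^ 2) =
      Real.cosh (catRadius m a w) := (Real.cosh_arsinh _).symm
  rw [h3, Real.rpow_sub_one hc.ne', catSpeed, Real.tanh_eq_sinh_div_cosh, sinh_catRadius]
  field_simp

lemma catSpeed_pos (hm : 0 < m) (ha : 0 < a) (w : ℝ) : 0 < catSpeed m a w := by
  have := Real.cosh_pos w
  have : 0 < Real.tanh (catRadius m a w) := by
    rw [Real.tanh_eq_sinh_div_cosh]
    exact div_pos (Real.sinh_pos_iff.2 (catRadius_pos ha w)) (Real.cosh_pos _)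
  unfold catSpeed
  positivity

lemma catSpeed_neg (m : ℕ) (a w : ℝ) : catSpeed m a (-w) = catSpeed m a w := by
  simp [catSpeed, catRadius_neg]

lemma hasDerivAt_catTime (hm : 0 < m) (a w : ℝ) :
    HasDerivAt (catTime m a) (catSpeed m a w) w :=
  ((contDiff_catSpeed hm a).continuous.integral_hasStrictDerivAt 0 w).hasDerivAt

lemma contDiff_catTime (hm : 0 < m) (a : ℝ) : ContDiff ℝ ∞ (catTime m a) := by
  rw [contDiff_infty_iff_deriv]
  refine ⟨fun w => (hasDerivAt_catTime hm a w).differentiableAt, ?_⟩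
  rw [show deriv (catTime m a) = catSpeed m a from
    funext fun w => (hasDerivAt_catTime hm a w).deriv]
  exact contDiff_catSpeed hm a

lemma strictMono_catTime (hm : 0 < m) (ha : 0 < a) : StrictMono (catTime m a) :=
  strictMono_of_hasDerivAt_pos (hasDerivAt_catTime hm a) fun w => catSpeed_pos hm ha w

lemma catTime_zero (m : ℕ) (a : ℝ) : catTime m a 0 = 0 := by simp [catTime]

lemma catTime_neg (m : ℕ) (a w : ℝ) : catTime m a (-w) = -catTime m a w := by
  have h := intervalIntegral.integral_comp_neg (a := 0) (b := w) (catSpeed m a)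
  simp only [catSpeed_neg, neg_zero] at h
  rw [catTime, catTime, h, intervalIntegral.integral_symm]

lemma hasDerivAt_arctan_sinh (w : ℝ) :
    HasDerivAt (fun w => Real.arctan (Real.sinh w)) (1 / Real.cosh w) w := by
  refine ((Real.hasDerivAt_arctan _).comp w (Real.hasDerivAt_sinh w)).congr_deriv ?_
  have := Real.cosh_pos w
  rw [add_comm, ← Real.cosh_sq]
  field_simp

lemma tendsto_sinh_atTop : Tendsto Real.sinh atTop atTop :=
  tendsto_atTop_mono' _ (by filter_upwards [eventually_ge_atTop 0] with x hx
                            exact Real.self_le_sinh_iff.2 hx) tendsto_id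

lemma tendsto_arctan_sinh :
    Tendsto (fun w => Real.arctan (Real.sinh w)) atTop (𝓝 (Real.pi / 2)) :=
  (Real.tendsto_arctan_atTop.mono_right nhdsWithin_le_nhds).comp tendsto_sinh_atTop

lemma integrableOn_one_div_cosh : IntegrableOn (fun w => 1 / Real.cosh w) (Ioi 0) :=
  integrableOn_Ioi_deriv_of_nonneg' (fun w _ => hasDerivAt_arctan_sinh w)
    (fun w _ => by have := Real.cosh_pos w; positivity) tendsto_arctan_sinh

lemma integral_one_div_cosh : ∫ w in Ioi (0 : ℝ), 1 / Real.cosh w = Real.pi / 2 := by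
  rw [integral_Ioi_of_hasDerivAt_of_nonneg' (fun w _ => hasDerivAt_arctan_sinh w)
    (fun w _ => by have := Real.cosh_pos w; positivity) tendsto_arctan_sinh]
  simp

lemma catSpeed_eq (m : ℕ) (a w : ℝ) :
    catSpeed m a w = Real.tanh (catRadius m a w) / m * (1 / Real.cosh w) := by
  unfold catSpeed; field_simp

/-- A bound for the speed that is uniform in `a`: it gives the integrability on `]0, ∞[` and serves
as the dominating function when `a` varies. -/
lemma catSpeed_le (hm : 0 < m) (a w : ℝ) : catSpeed m a w ≤ 1 / Real.cosh w := by
  rw [catSpeed_eq]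
  have := Real.cosh_pos w
  refine mul_le_of_le_one_left (by positivity) ?_
  rw [div_le_one (by positivity)]
  exact (Real.tanh_lt_one _).le.trans (by exact_mod_cast hm)

lemma integrableOn_catSpeed (hm : 0 < m) (ha : 0 < a) : IntegrableOn (catSpeed m a) (Ioi 0) := by
  refine integrableOn_one_div_cosh.mono'
    (contDiff_catSpeed hm a).continuous.aestronglyMeasurable (Eventually.of_forall fun w => ?_)
  rw [Real.norm_of_nonneg (catSpeed_pos hm ha w).le]
  exact catSpeed_le hm a w

lemma tendsto_catTime (hm : 0 < m) (ha : 0 < a) :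
    Tendsto (catTime m a) atTop (𝓝 (catHalf m a)) :=
  intervalIntegral_tendsto_integral_Ioi 0 (integrableOn_catSpeed hm ha) tendsto_id

lemma catTime_lt_catHalf (hm : 0 < m) (ha : 0 < a) (w : ℝ) : catTime m a w < catHalf m a :=
  (strictMono_catTime hm ha (lt_add_one w)).trans_le
    ((strictMono_catTime hm ha).monotone.ge_of_tendsto (tendsto_catTime hm ha) _)

lemma catHalf_pos (hm : 0 < m) (ha : 0 < a) : 0 < catHalf m a := by
  simpa [catTime_zero] using catTime_lt_catHalf hm ha 0

lemma range_catTime (hm : 0 < m) (ha : 0 < a) :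
    range (catTime m a) = Ioo (-catHalf m a) (catHalf m a) := by
  apply Subset.antisymm
  · rintro _ ⟨w, rfl⟩
    refine ⟨?_, catTime_lt_catHalf hm ha w⟩
    have := catTime_lt_catHalf hm ha (-w)
    rw [catTime_neg] at this
    linarith
  · rintro t ⟨h1, h2⟩
    obtain ⟨w1, hw1⟩ := ((tendsto_catTime hm ha).eventually_const_lt h2).exists
    obtain ⟨w2, hw2⟩ := ((tendsto_catTime hm ha).eventually_const_lt
      (show -t < catHalf m a by linarith)).exists
    have hc := (contDiff_catTime hm a).continuous
    refine mem_range_of_exists_le_of_exists_ge hc ⟨-w2, ?_⟩ ⟨w1, hw1.le⟩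
    rw [catTime_neg]; linarith

/-- The slope parameter of the catenary at height `t`, inverse of `catTime m a`. The values for
`|t| ≥ catHalf m a` are irrelevant. -/
def catParam (m : ℕ) (a : ℝ) : ℝ → ℝ := Function.invFun (catTime m a)

lemma catParam_catTime (hm : 0 < m) (ha : 0 < a) (w : ℝ) : catParam m a (catTime m a w) = w :=
  Function.leftInverse_invFun (strictMono_catTime hm ha).injective w

lemma catTime_catParam (hm : 0 < m) (ha : 0 < a) {t : ℝ}
    (ht : t ∈ Ioo (-catHalf m a) (catHalf m a)) : catTime m a (catParam m a t) = t := by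
  rw [← range_catTime hm ha] at ht
  exact Function.invFun_eq ht

lemma isOpenEmbedding_catTime (hm : 0 < m) (ha : 0 < a) : IsOpenEmbedding (catTime m a) := by
  refine IsOpenEmbedding.of_continuous_injective_isOpenMap (contDiff_catTime hm a).continuous
    (strictMono_catTime hm ha).injective (isOpenMap_of_hasStrictDerivAt (f' := catSpeed m a)
      (fun w => ?_) fun w => (catSpeed_pos hm ha w).ne')
  exact (contDiff_catSpeed hm a).continuous.integral_hasStrictDerivAt 0 w

lemma contDiffAt_catParam (hm : 0 < m) (ha : 0 < a) {t : ℝ}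
    (ht : t ∈ Ioo (-catHalf m a) (catHalf m a)) : ContDiffAt ℝ ∞ (catParam m a) t := by
  let e := (isOpenEmbedding_catTime hm ha).toOpenPartialHomeomorph
  have htgt : e.target = Ioo (-catHalf m a) (catHalf m a) := by
    simp [e, range_catTime hm ha]
  have he : ∀ s ∈ Ioo (-catHalf m a) (catHalf m a), e.symm s = catParam m a s := by
    intro s hs
    have h1 : e (e.symm s) = s := e.right_inv (htgt ▸ hs)
    have h2 : catTime m a (e.symm s) = s := by simpa [e] using h1
    rw [← h2, catParam_catTime hm ha, h2]
  have h := e.contDiffAt_symm_deriv (n := ∞) (catSpeed_pos hm ha (e.symm t)).ne' (htgt ▸ ht)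
    (by simpa [e] using hasDerivAt_catTime hm a _)
    (by simpa [e] using (contDiff_catTime hm a).contDiffAt)
  refine h.congr_of_eventuallyEq ?_
  filter_upwards [isOpen_Ioo.mem_nhds ht] with s hs using (he s hs).symm

lemma hasDerivAt_catParam (hm : 0 < m) (ha : 0 < a) {t : ℝ}
    (ht : t ∈ Ioo (-catHalf m a) (catHalf m a)) :
    HasDerivAt (catParam m a) (catSpeed m a (catParam m a t))⁻¹ t := by
  refine HasDerivAt.of_local_left_inverse (contDiffAt_catParam hm ha ht).continuousAt
    (hasDerivAt_catTime hm a _) (catSpeed_pos hm ha _).ne' ?_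
  filter_upwards [isOpen_Ioo.mem_nhds ht] with s hs using catTime_catParam hm ha hs

lemma catParam_neg (hm : 0 < m) (ha : 0 < a) {t : ℝ}
    (ht : t ∈ Ioo (-catHalf m a) (catHalf m a)) : catParam m a (-t) = -catParam m a t := by
  apply (strictMono_catTime hm ha).injective
  rw [catTime_neg, catTime_catParam hm ha ht,
    catTime_catParam hm ha ⟨by linarith [ht.2], by linarith [ht.1]⟩]

lemma catParam_zero (hm : 0 < m) (ha : 0 < a) : catParam m a 0 = 0 := by
  simpa [catTime_zero] using catParam_catTime hm ha 0

/-- The solution of the Cauchy problem, obtained by inverting the time as a function of the slope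
parameter. -/
def catProfile (m : ℕ) (a t : ℝ) : ℝ := catRadius m a (catParam m a t)

lemma contDiffAt_catProfile (hm : 0 < m) (ha : 0 < a) {t : ℝ}
    (ht : t ∈ Ioo (-catHalf m a) (catHalf m a)) : ContDiffAt ℝ ∞ (catProfile m a) t :=
  (contDiff_catRadius m a).contDiffAt.comp t (contDiffAt_catParam hm ha ht)

lemma hasDerivAt_catProfile (hm : 0 < m) (ha : 0 < a) {t : ℝ}
    (ht : t ∈ Ioo (-catHalf m a) (catHalf m a)) :
    HasDerivAt (catProfile m a) (Real.sinh (catParam m a t)) t := by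
  refine ((hasDerivAt_catRadius m a _).comp t (hasDerivAt_catParam hm ha ht)).congr_deriv ?_
  field_simp [(catSpeed_pos hm ha (catParam m a t)).ne']

lemma hasDerivAt_deriv_catProfile (hm : 0 < m) (ha : 0 < a) {t : ℝ}
    (ht : t ∈ Ioo (-catHalf m a) (catHalf m a)) :
    HasDerivAt (deriv (catProfile m a))
      (m * (Real.cosh (catProfile m a t) / Real.sinh (catProfile m a t)) *
        (1 + deriv (catProfile m a) t ^ 2)) t := by
  have h1 : deriv (catProfile m a) =ᶠ[𝓝 t] fun s => Real.sinh (catParam m a s) := by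
    filter_upwards [isOpen_Ioo.mem_nhds ht] with s hs using (hasDerivAt_catProfile hm ha hs).deriv
  refine HasDerivAt.congr_of_eventuallyEq ?_ h1
  refine ((Real.hasDerivAt_sinh _).comp t (hasDerivAt_catParam hm ha ht)).congr_deriv ?_
  rw [(hasDerivAt_catProfile hm ha ht).deriv, catSpeed, add_comm, ← Real.cosh_sq,
    Real.tanh_eq_sinh_div_cosh, catProfile]
  have h2 := (Real.sinh_pos_iff.2 (catRadius_pos (m := m) ha (catParam m a t))).ne'
  have h3 := (Real.cosh_pos (catRadius m a (catParam m a t))).ne'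
  have h4 := (Real.cosh_pos (catParam m a t)).ne'
  field_simp

end Profile

/-! ### Existence and uniqueness of the maximal solution -/

noncomputable section Solution

variable {n m : ℕ} {a b : ℝ}

/-- The interval of definition `]-T, T[` of the maximal solution. -/
def catInterval (m : ℕ) (a : ℝ) : TopologicalSpace.Opens ℝ :=
  ⟨Ioo (-catHalf m a) (catHalf m a), isOpen_Ioo⟩

lemma isCatenarySolution_catProfile (hn : 2 ≤ n) (ha : 0 < a) :
    IsCatenarySolution n a (catInterval (n - 1) a) (catProfile (n - 1) a) := by
  have hm : 0 < n - 1 := by omega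
  have h0 := catHalf_pos hm ha
  have hz : (0 : ℝ) ∈ Ioo (-catHalf (n - 1) a) (catHalf (n - 1) a) := ⟨by linarith, h0⟩
  refine ⟨ordConnected_Ioo, hz, fun t _ => catRadius_pos ha _,
    fun t ht => (hasDerivAt_catProfile hm ha ht).differentiableAt, fun t ht => ?_, ?_, ?_⟩
  · have h := hasDerivAt_deriv_catProfile hm ha ht
    rwa [Nat.cast_sub (by omega), Nat.cast_one] at h
  · rw [catProfile, catParam_zero hm ha, catRadius_zero]
  · rw [(hasDerivAt_catProfile hm ha hz).deriv, catParam_zero hm ha, Real.sinh_zero]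

lemma eqOn_of_hasDerivAt_zero {s : Set ℝ} (hs : IsOpen s) (hs' : s.OrdConnected) {Q : ℝ → ℝ}
    (h : ∀ t ∈ s, HasDerivAt Q 0 t) {x y : ℝ} (hx : x ∈ s) (hy : y ∈ s) : Q x = Q y :=
  hs.is_const_of_deriv_eq_zero hs'.isPreconnected
    (fun t ht => (h t ht).differentiableAt.differentiableWithinAt) (fun t ht => (h t ht).deriv) hx hy

/-- Every solution is a restriction of `catProfile`. With `w = arsinh g'`, the quotient
`cosh w / sinh^{n-1} g` is constant, so that `g = catRadius w`; then `catTime (w t)` has derivative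
one and hence equals `t`, which determines `w`. -/
lemma IsCatenarySolution.eq_catProfile {I : TopologicalSpace.Opens ℝ} {g : ℝ → ℝ}
    (hn : 2 ≤ n) (ha : 0 < a) (hg : IsCatenarySolution n a I g) {t : ℝ} (ht : t ∈ I) :
    t ∈ catInterval (n - 1) a ∧ g t = catProfile (n - 1) a t := by
  obtain ⟨k, rfl⟩ : ∃ k, n = k + 2 := ⟨n - 2, by omega⟩
  have hm : 0 < k + 1 := k.succ_pos
  rw [show k + 2 - 1 = k + 1 from rfl]
  set w : ℝ → ℝ := fun t => Real.arsinh (deriv g t) with hw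
  have hcosh : ∀ t, 0 < Real.cosh (w t) := fun t => Real.cosh_pos _
  have hsinh : ∀ t, Real.sinh (w t) = deriv g t := fun t => Real.sinh_arsinh _
  have hsg : ∀ t ∈ I, 0 < Real.sinh (g t) := fun t ht => Real.sinh_pos_iff.2 (hg.pos t ht)
  have hg' : ∀ t ∈ I, HasDerivAt g (Real.sinh (w t)) t := fun t ht => by
    rw [hsinh]; exact (hg.differentiableAt t ht).hasDerivAt
  have hw' : ∀ t ∈ I, HasDerivAt w
      ((k + 1) * (Real.cosh (g t) / Real.sinh (g t)) * Real.cosh (w t)) t := fun t ht => by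
    refine ((Real.hasDerivAt_arsinh _).comp t (hg.ode t ht)).congr_deriv ?_
    have h1 : √(1 + deriv g t ^ 2) = Real.cosh (w t) := (Real.cosh_arsinh _).symm
    have h2 : 1 + deriv g t ^ 2 = Real.cosh (w t) ^ 2 := by rw [← hsinh, add_comm, Real.cosh_sq]
    rw [h1, h2]
    have := (hcosh t).ne'
    have := (hsg t ht).ne'
    push_cast
    field_simp
    ring
  -- the first integral `cosh w / sinh^{n-1} g`
  have hQ : ∀ t ∈ I, Real.cosh (w t) / Real.sinh (g t) ^ (k + 1) =
      Real.cosh (w 0) / Real.sinh (g 0) ^ (k + 1) := by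
    intro t ht
    refine eqOn_of_hasDerivAt_zero I.isOpen hg.ordConnected
      (Q := fun t => Real.cosh (w t) / Real.sinh (g t) ^ (k + 1)) (fun s hs => ?_) ht hg.zero_mem
    have hs' := (hsg s hs).ne'
    refine ((hw' s hs).cosh.div ((hg' s hs).sinh.pow (k + 1))
      (pow_ne_zero _ hs')).congr_deriv ?_
    rw [div_eq_zero_iff]
    left
    simp only [Nat.add_sub_cancel, pow_succ, Pi.pow_apply]
    push_cast
    field_simp
    ring
  have hw0 : w 0 = 0 := by simp [hw, hg.deriv_init]
  have hR : ∀ t ∈ I, g t = catRadius (k + 1) a (w t) := fun t ht => by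
    refine eq_catRadius hm ha (hg.pos t ht) ?_
    have h := hQ t ht
    rw [hw0, hg.init, Real.cosh_zero, div_eq_div_iff (pow_pos (hsg t ht) _).ne'
      (pow_pos (Real.sinh_pos_iff.2 ha) _).ne'] at h
    linarith
  have hT : ∀ t ∈ I, catTime (k + 1) a (w t) = t := by
    intro t ht
    have h := eqOn_of_hasDerivAt_zero I.isOpen hg.ordConnected
      (Q := fun t => catTime (k + 1) a (w t) - t) (fun s hs => ?_) ht hg.zero_mem
    · simp only [hw0, catTime_zero, sub_zero] at h
      linarith
    · refine (((hasDerivAt_catTime hm a _).comp s (hw' s hs)).sub (hasDerivAt_id s)).congr_deriv ?_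
      rw [catSpeed, ← hR s hs, Real.tanh_eq_sinh_div_cosh]
      have := (hsg s hs).ne'
      have := (hcosh s).ne'
      have := (Real.cosh_pos (g s)).ne'
      push_cast
      field_simp
      ring
  have hmem : t ∈ Ioo (-catHalf (k + 1) a) (catHalf (k + 1) a) := by
    rw [← range_catTime hm ha]; exact ⟨_, hT t ht⟩
  refine ⟨hmem, ?_⟩
  have h : catParam (k + 1) a t = w t := by
    conv_lhs => rw [← hT t ht]
    exact catParam_catTime hm ha _
  rw [catProfile, h, hR t ht]

lemma isMaximalCatenarySolution_catProfile (hn : 2 ≤ n) (ha : 0 < a) :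
    IsMaximalCatenarySolution n a (catInterval (n - 1) a) (catProfile (n - 1) a) where
  toIsCatenarySolution := isCatenarySolution_catProfile hn ha
  maximal _ _ hg hle _ := le_antisymm (fun _ ht => (hg.eq_catProfile hn ha ht).1) hle

lemma IsMaximalCatenarySolution.eq_catProfile {I : TopologicalSpace.Opens ℝ} {g : ℝ → ℝ}
    (hn : 2 ≤ n) (ha : 0 < a) (hg : IsMaximalCatenarySolution n a I g) :
    I = catInterval (n - 1) a ∧ EqOn g (catProfile (n - 1) a) I :=
  ⟨(hg.maximal _ _ (isCatenarySolution_catProfile hn ha)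
    (fun _ ht => (hg.toIsCatenarySolution.eq_catProfile hn ha ht).1)
    fun _ ht => (hg.toIsCatenarySolution.eq_catProfile hn ha ht).2.symm).symm,
    fun _ ht => (hg.toIsCatenarySolution.eq_catProfile hn ha ht).2⟩

end Solution

/-! ### The inverse function of the profile as an integral -/

noncomputable section Height

variable {n m : ℕ} {a b : ℝ}

/-- `(sinh ρ / sinh a)^m`, which is `cosh w` at the point of the catenary of radius `ρ`. -/
def sinhRatioPow (m : ℕ) (a ρ : ℝ) : ℝ := (Real.sinh ρ / Real.sinh a) ^ m

/-- The height `≥ 0` at which the catenary reaches the radius `ρ ≥ a`. It is a primitive of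
`(sinhRatioPow m a ρ ^ 2 - 1)^{-1/2}` on `]a, ∞[`. -/
def invTime (m : ℕ) (a ρ : ℝ) : ℝ := catTime m a (Real.arcosh (sinhRatioPow m a ρ))

lemma one_le_sinhRatioPow (ha : 0 < a) {ρ : ℝ} (hρ : a ≤ ρ) : 1 ≤ sinhRatioPow m a ρ :=
  one_le_pow₀ ((one_le_div (Real.sinh_pos_iff.2 ha)).2 (Real.sinh_le_sinh.2 hρ))

lemma one_lt_sinhRatioPow (hm : 0 < m) (ha : 0 < a) {ρ : ℝ} (hρ : a < ρ) :
    1 < sinhRatioPow m a ρ :=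
  one_lt_pow₀ ((one_lt_div (Real.sinh_pos_iff.2 ha)).2 (Real.sinh_lt_sinh.2 hρ)) hm.ne'

lemma catRadius_arcosh (hm : 0 < m) (ha : 0 < a) {ρ : ℝ} (hρ : a ≤ ρ) :
    catRadius m a (Real.arcosh (sinhRatioPow m a ρ)) = ρ := by
  refine (eq_catRadius hm ha (ha.trans_le hρ) ?_).symm
  have := (Real.sinh_pos_iff.2 ha).ne'
  rw [Real.cosh_arcosh (one_le_sinhRatioPow ha hρ), sinhRatioPow, div_pow]
  field_simp

lemma invTime_catRadius (hm : 0 < m) (ha : 0 < a) {w : ℝ} (hw : 0 ≤ w) :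
    invTime m a (catRadius m a w) = catTime m a w := by
  have := (Real.sinh_pos_iff.2 ha).ne'
  have h : sinhRatioPow m a (catRadius m a w) = Real.cosh w := by
    rw [sinhRatioPow, div_pow, sinh_catRadius_pow hm]
    field_simp
  rw [invTime, h, Real.arcosh_cosh hw]

lemma invTime_self (hm : 0 < m) (ha : 0 < a) : invTime m a a = 0 := by
  have h := invTime_catRadius hm ha le_rfl
  rwa [catRadius_zero, catTime_zero] at h

lemma continuous_sinhRatioPow (m : ℕ) (a : ℝ) : Continuous (sinhRatioPow m a) := by
  unfold sinhRatioPow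
  exact (Real.continuous_sinh.div_const _).pow m

lemma continuousOn_invTime (hm : 0 < m) (ha : 0 < a) : ContinuousOn (invTime m a) (Ici a) :=
  (contDiff_catTime hm a).continuous.comp_continuousOn
    (Real.continuousOn_arcosh.comp (continuous_sinhRatioPow m a).continuousOn
      fun _ hρ => one_le_sinhRatioPow ha hρ)

lemma hasDerivAt_invTime (hm : 0 < m) (ha : 0 < a) {ρ : ℝ} (hρ : a < ρ) :
    HasDerivAt (invTime m a) (√(sinhRatioPow m a ρ ^ 2 - 1))⁻¹ ρ := by
  have hsa := Real.sinh_pos_iff.2 ha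
  have hsρ := Real.sinh_pos_iff.2 (ha.trans hρ)
  have hcρ := Real.cosh_pos ρ
  have h1 := one_lt_sinhRatioPow hm ha hρ
  have hx : HasDerivAt (sinhRatioPow m a)
      (m * sinhRatioPow m a ρ * (Real.cosh ρ / Real.sinh ρ)) ρ := by
    refine (((Real.hasDerivAt_sinh ρ).div_const (Real.sinh a)).pow m).congr_deriv ?_
    obtain ⟨k, rfl⟩ : ∃ k, m = k + 1 := ⟨m - 1, by omega⟩
    simp only [sinhRatioPow, Nat.add_sub_cancel, pow_succ]
    field_simp
  refine ((hasDerivAt_catTime hm a _).comp ρ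
    ((Real.hasDerivAt_arcosh h1).comp ρ hx)).congr_deriv ?_
  rw [Function.comp_apply, catSpeed, catRadius_arcosh hm ha hρ.le, Real.cosh_arcosh h1.le,
    Real.tanh_eq_sinh_div_cosh]
  have h2 : (0 : ℝ) < sinhRatioPow m a ρ := zero_lt_one.trans h1
  have h3 : (0 : ℝ) < m := by exact_mod_cast hm
  field_simp

lemma inv_sqrt_eq_catenaryIntegrand (hn : 2 ≤ n) (ha : 0 < a) {ρ : ℝ} (hρ : a < ρ) :
    (√(sinhRatioPow (n - 1) a ρ ^ 2 - 1))⁻¹ =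
      Real.sinh a ^ (n - 1) * catenaryIntegrand n a ρ := by
  have hsa := Real.sinh_pos_iff.2 ha
  have h2 : 2 * n - 2 = (n - 1) * 2 := by omega
  have hlt : Real.sinh a ^ (2 * n - 2) < Real.sinh ρ ^ (2 * n - 2) :=
    pow_lt_pow_left₀ (Real.sinh_lt_sinh.2 hρ) hsa.le (by omega)
  have hd : 0 < Real.sinh ρ ^ (2 * n - 2) - Real.sinh a ^ (2 * n - 2) := sub_pos.2 hlt
  have h3 : sinhRatioPow (n - 1) a ρ ^ 2 - 1 =
      (Real.sinh ρ ^ (2 * n - 2) - Real.sinh a ^ (2 * n - 2)) / (Real.sinh a ^ (n - 1)) ^ 2 := by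
    rw [sinhRatioPow, ← pow_mul, ← pow_mul, h2, div_pow]
    field_simp
  rw [h3, Real.sqrt_div hd.le, Real.sqrt_sq (by positivity), catenaryIntegrand,
    Real.rpow_neg hd.le, ← Real.sqrt_eq_rpow, inv_div, div_eq_mul_inv]

lemma hasDerivAt_invTime' (hn : 2 ≤ n) (ha : 0 < a) {ρ : ℝ} (hρ : a < ρ) :
    HasDerivAt (invTime (n - 1) a) (Real.sinh a ^ (n - 1) * catenaryIntegrand n a ρ) ρ := by
  rw [← inv_sqrt_eq_catenaryIntegrand hn ha hρ]
  exact hasDerivAt_invTime (by omega) ha hρ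

lemma mul_catenaryIntegrand_nonneg (hn : 2 ≤ n) (ha : 0 < a) {ρ : ℝ} (hρ : a < ρ) :
    0 ≤ Real.sinh a ^ (n - 1) * catenaryIntegrand n a ρ := by
  rw [← inv_sqrt_eq_catenaryIntegrand hn ha hρ]
  positivity

/-- The singular integrand is integrable because it is nonnegative and has, up to a factor, the
primitive `invTime`, continuous up to `a`. -/
lemma intervalIntegrable_catenaryIntegrand (hn : 2 ≤ n) (ha : 0 < a) {ρ : ℝ} (hρ : a ≤ ρ) :
    IntervalIntegrable (catenaryIntegrand n a) volume a ρ := by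
  have h : IntervalIntegrable (fun u => Real.sinh a ^ (n - 1) * catenaryIntegrand n a u)
      volume a ρ := by
    refine intervalIntegral.intervalIntegrable_deriv_of_nonneg (g := invTime (n - 1) a) ?_ ?_ ?_
    · rw [uIcc_of_le hρ]
      exact (continuousOn_invTime (by omega) ha).mono Icc_subset_Ici_self
    · intro u hu
      rw [min_eq_left hρ] at hu
      exact hasDerivAt_invTime' hn ha hu.1
    · intro u hu
      rw [min_eq_left hρ] at hu
      exact mul_catenaryIntegrand_nonneg hn ha hu.1
  have h2 := h.const_mul (Real.sinh a ^ (n - 1))⁻¹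
  have h3 := (pow_pos (Real.sinh_pos_iff.2 ha) (n - 1)).ne'
  simpa [← mul_assoc, inv_mul_cancel₀ h3] using h2

lemma catenaryInverse_eq (hn : 2 ≤ n) (ha : 0 < a) {ρ : ℝ} (hρ : a ≤ ρ) :
    catenaryInverse n a ρ = invTime (n - 1) a ρ := by
  rw [catenaryInverse, ← intervalIntegral.integral_const_mul,
    intervalIntegral.integral_eq_sub_of_hasDerivAt_of_le hρ
      ((continuousOn_invTime (by omega) ha).mono Icc_subset_Ici_self)
      (fun u hu => hasDerivAt_invTime' hn ha hu.1)
      ((intervalIntegrable_catenaryIntegrand hn ha hρ).const_mul _),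
    invTime_self (by omega) ha, sub_zero]

lemma tendsto_arcosh_atTop : Tendsto Real.arcosh atTop atTop := by
  refine tendsto_atTop.2 fun c => ?_
  filter_upwards [eventually_ge_atTop (Real.cosh |c|)] with y hy
  have h := (Real.arcosh_le_arcosh (Real.cosh_pos _) ((Real.cosh_pos _).trans_le hy)).2 hy
  rw [Real.arcosh_cosh (abs_nonneg c)] at h
  exact (le_abs_self c).trans h

lemma tendsto_invTime (hm : 0 < m) (ha : 0 < a) :
    Tendsto (invTime m a) atTop (𝓝 (catHalf m a)) := by
  have h : Tendsto (sinhRatioPow m a) atTop atTop :=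
    (tendsto_pow_atTop hm.ne').comp (tendsto_sinh_atTop.atTop_div_const (Real.sinh_pos_iff.2 ha))
  exact (tendsto_catTime hm ha).comp (tendsto_arcosh_atTop.comp h)

lemma integrableOn_catenaryIntegrand (hn : 2 ≤ n) (ha : 0 < a) :
    IntegrableOn (catenaryIntegrand n a) (Ioi a) := by
  have h : IntegrableOn (fun u => Real.sinh a ^ (n - 1) * catenaryIntegrand n a u) (Ioi a) :=
    integrableOn_Ioi_deriv_of_nonneg
      ((continuousOn_invTime (by omega) ha) a self_mem_Ici)
      (fun u hu => hasDerivAt_invTime' hn ha hu)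
      (fun u hu => mul_catenaryIntegrand_nonneg hn ha hu) (tendsto_invTime (by omega) ha)
  have h2 := Integrable.const_mul h (Real.sinh a ^ (n - 1))⁻¹
  have h3 := (pow_pos (Real.sinh_pos_iff.2 ha) (n - 1)).ne'
  simpa [IntegrableOn, ← mul_assoc, inv_mul_cancel₀ h3] using h2

lemma integral_catenaryIntegrand (hn : 2 ≤ n) (ha : 0 < a) :
    Real.sinh a ^ (n - 1) * ∫ u in Ioi a, catenaryIntegrand n a u = catHalf (n - 1) a := by
  rw [← integral_const_mul, integral_Ioi_of_hasDerivAt_of_nonneg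
      ((continuousOn_invTime (by omega) ha) a self_mem_Ici)
      (fun u hu => hasDerivAt_invTime' hn ha hu)
      (fun u hu => mul_catenaryIntegrand_nonneg hn ha hu) (tendsto_invTime (by omega) ha),
      invTime_self (by omega) ha, sub_zero]

lemma catParam_nonneg (hm : 0 < m) (ha : 0 < a) {t : ℝ} (ht : t ∈ Ico 0 (catHalf m a)) :
    0 ≤ catParam m a t := by
  rw [← (strictMono_catTime hm ha).le_iff_le, catTime_zero,
    catTime_catParam hm ha ⟨by linarith [ht.1, ht.2], ht.2⟩]
  exact ht.1

lemma catParam_pos (hm : 0 < m) (ha : 0 < a) {t : ℝ} (ht : t ∈ Ioo 0 (catHalf m a)) :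
    0 < catParam m a t := by
  rw [← (strictMono_catTime hm ha).lt_iff_lt, catTime_zero,
    catTime_catParam hm ha ⟨by linarith [ht.1, ht.2], ht.2⟩]
  exact ht.1

lemma invTime_catProfile (hm : 0 < m) (ha : 0 < a) {t : ℝ} (ht : t ∈ Ico 0 (catHalf m a)) :
    invTime m a (catProfile m a t) = t := by
  rw [catProfile, invTime_catRadius hm ha (catParam_nonneg hm ha ht),
    catTime_catParam hm ha ⟨by linarith [ht.1, ht.2], ht.2⟩]

lemma catProfile_invTime (hm : 0 < m) (ha : 0 < a) {ρ : ℝ} (hρ : a ≤ ρ) :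
    catProfile m a (invTime m a ρ) = ρ := by
  rw [catProfile, invTime, catParam_catTime hm ha, catRadius_arcosh hm ha hρ]

lemma invTime_mem (hm : 0 < m) (ha : 0 < a) {ρ : ℝ} (hρ : a ≤ ρ) :
    invTime m a ρ ∈ Ico 0 (catHalf m a) := by
  refine ⟨?_, catTime_lt_catHalf hm ha _⟩
  rw [← catTime_zero m a]
  exact (strictMono_catTime hm ha).monotone (Real.arcosh_nonneg (one_le_sinhRatioPow ha hρ))

lemma catProfile_neg (hm : 0 < m) (ha : 0 < a) {t : ℝ}
    (ht : t ∈ Ioo (-catHalf m a) (catHalf m a)) : catProfile m a (-t) = catProfile m a t := by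
  rw [catProfile, catParam_neg hm ha ht, catRadius_neg, catProfile]

lemma le_catProfile (ha : 0 < a) (t : ℝ) : a ≤ catProfile m a t := le_catRadius ha _

/-! ### The height as a function of the initial value -/

lemma catRadius_strictMono (m : ℕ) (w : ℝ) : StrictMono fun a => catRadius m a w := fun _ _ h =>
  Real.arsinh_lt_arsinh.2 (mul_lt_mul_of_pos_right (Real.sinh_lt_sinh.2 h)
    (Real.rpow_pos_of_pos (Real.cosh_pos w) _))

lemma catSpeed_strictMono (hm : 0 < m) (w : ℝ) : StrictMono fun a => catSpeed m a w :=
  fun _ _ h => div_lt_div_of_pos_right (strictMono_tanh (catRadius_strictMono m w h))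
    (mul_pos (by exact_mod_cast hm) (Real.cosh_pos w))

lemma catHalf_strictMonoOn (hm : 0 < m) : StrictMonoOn (catHalf m) (Ioi 0) := by
  intro a ha b hb hab
  have hd : ∀ w, 0 < catSpeed m b w - catSpeed m a w := fun w =>
    sub_pos.2 (catSpeed_strictMono hm w hab)
  have hi := (integrableOn_catSpeed hm hb).sub (integrableOn_catSpeed hm ha)
  have h : 0 < ∫ w in Ioi (0 : ℝ), (catSpeed m b w - catSpeed m a w) := by
    rw [setIntegral_pos_iff_support_of_nonneg_ae (Eventually.of_forall fun w => (hd w).le) hi,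
      show (Function.support fun w => catSpeed m b w - catSpeed m a w) = univ from
        eq_univ_of_forall fun w => (hd w).ne']
    simp
  rw [integral_sub (integrableOn_catSpeed hm hb) (integrableOn_catSpeed hm ha)] at h
  exact sub_pos.1 h

/-- Dominated convergence for the half height. -/
lemma tendsto_catHalf {l : Filter ℝ} [l.IsCountablyGenerated] (hm : 0 < m)
    (hl : ∀ᶠ a in l, 0 < a) {g : ℝ → ℝ}
    (h : ∀ w, Tendsto (fun a => catSpeed m a w) l (𝓝 (g w))) :
    Tendsto (catHalf m) l (𝓝 (∫ w in Ioi (0 : ℝ), g w)) := by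
  refine tendsto_integral_filter_of_dominated_convergence (fun w => 1 / Real.cosh w)
    (Eventually.of_forall fun a => (contDiff_catSpeed hm a).continuous.aestronglyMeasurable) ?_
    integrableOn_one_div_cosh (Eventually.of_forall h)
  filter_upwards [hl] with a ha
  refine Eventually.of_forall fun w => ?_
  rw [Real.norm_of_nonneg (catSpeed_pos hm ha w).le]
  exact catSpeed_le hm a w

lemma tendsto_catHalf_zero (hm : 0 < m) : Tendsto (catHalf m) (𝓝[>] 0) (𝓝 0) := by
  have h := tendsto_catHalf (l := 𝓝[>] 0) (g := fun _ => 0) hm self_mem_nhdsWithin fun w => ?_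
  · simpa using h
  · have hc : Continuous fun a => catSpeed m a w := by
      unfold catSpeed catRadius
      exact (contDiff_tanh.continuous.comp (Real.continuous_arsinh.comp
        (Real.continuous_sinh.mul continuous_const))).div_const _
    have := hc.tendsto 0
    simp only [catSpeed, catRadius, Real.sinh_zero, zero_mul, Real.arsinh_zero, Real.tanh_zero,
      zero_div] at this
    exact this.mono_left nhdsWithin_le_nhds

lemma tendsto_catHalf_atTop (hm : 0 < m) :
    Tendsto (catHalf m) atTop (𝓝 (Real.pi / 2 / m)) := by
  have h := tendsto_catHalf (l := atTop) (g := fun w => 1 / m * (1 / Real.cosh w)) hm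
    (eventually_gt_atTop 0) fun w => ?_
  · rw [integral_const_mul, integral_one_div_cosh] at h
    convert h using 2
    ring
  · have h1 : Tendsto (fun a => catRadius m a w) atTop atTop := by
      refine tendsto_atTop_mono' _ ?_ tendsto_id
      filter_upwards [eventually_gt_atTop 0] with a ha using le_catRadius ha w
    simp only [catSpeed_eq]
    exact ((tendsto_tanh_atTop.comp h1).div_const _).mul_const _

/-! ### Intersection of two catenaries -/

lemma sinhRatioPow_lt (hm : 0 < m) (ha : 0 < a) (hab : a < b) {ρ : ℝ} (hρ : b < ρ) :
    sinhRatioPow m b ρ < sinhRatioPow m a ρ := by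
  have hsa := Real.sinh_pos_iff.2 ha
  have hsρ := Real.sinh_pos_iff.2 (ha.trans (hab.trans hρ))
  have hsb := Real.sinh_pos_iff.2 (ha.trans hab)
  exact pow_lt_pow_left₀ (div_lt_div_of_pos_left hsρ hsa (Real.sinh_lt_sinh.2 hab)) (by positivity)
    hm.ne'

/-- The reason why two catenaries cross only once in the upper half plane: at a given radius, the
slope `f'` is smaller for the catenary with the larger neck, so that its height grows faster. -/
lemma strictMonoOn_invTime_sub (hm : 0 < m) (ha : 0 < a) (hab : a < b) :
    StrictMonoOn (fun ρ => invTime m b ρ - invTime m a ρ) (Ici b) := by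
  have hb := ha.trans hab
  refine strictMonoOn_of_deriv_pos (convex_Ici b) ((continuousOn_invTime hm hb).sub
    ((continuousOn_invTime hm ha).mono (Ici_subset_Ici.2 hab.le))) fun ρ hρ => ?_
  rw [interior_Ici] at hρ
  have hρ' : b < ρ := hρ
  rw [((hasDerivAt_invTime hm hb hρ').fun_sub (hasDerivAt_invTime hm ha (hab.trans hρ'))).deriv]
  have h1 := one_lt_sinhRatioPow hm hb hρ'
  have h2 := sinhRatioPow_lt hm ha hab hρ'
  rw [sub_pos]
  have h3 : 0 < sinhRatioPow m b ρ ^ 2 - 1 := by nlinarith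
  refine inv_strictAnti₀ (Real.sqrt_pos.2 h3) (Real.sqrt_lt_sqrt h3.le ?_)
  nlinarith

lemma exists_crossing (hm : 0 < m) (ha : 0 < a) (hab : a < b) :
    ∃ ρ, b < ρ ∧ invTime m b ρ = invTime m a ρ := by
  have hb := ha.trans hab
  have hcont : ContinuousOn (fun ρ => invTime m b ρ - invTime m a ρ) (Ici b) :=
    (continuousOn_invTime hm hb).sub
      ((continuousOn_invTime hm ha).mono (Ici_subset_Ici.2 hab.le))
  have h0 : invTime m b b - invTime m a b < 0 := by
    rw [invTime_self hm hb, zero_sub, neg_lt_zero, invTime, ← catTime_zero m a]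
    exact strictMono_catTime hm ha (Real.arcosh_pos (one_lt_sinhRatioPow hm ha hab))
  have hlim := (tendsto_invTime hm hb).sub (tendsto_invTime hm ha)
  obtain ⟨c, hc, hbc⟩ := ((hlim.eventually_const_lt
    (sub_pos.2 (catHalf_strictMonoOn hm ha hb hab))).and (eventually_ge_atTop b)).exists
  obtain ⟨ρ, hρ, hρ0⟩ := intermediate_value_Icc hbc (hcont.mono Icc_subset_Ici_self)
    ⟨h0.le, hc.le⟩
  refine ⟨ρ, lt_of_le_of_ne hρ.1 ?_, sub_eq_zero.1 hρ0⟩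
  rintro rfl
  exact h0.ne hρ0

lemma tanh_half_inj {x y : ℝ} : Real.tanh (x / 2) = Real.tanh (y / 2) ↔ x = y := by
  rw [strictMono_tanh.injective.eq_iff]
  constructor <;> intro h <;> linarith

lemma inter_generatingCurve_of_lt (hm : 0 < m) (ha : 0 < a) (hab : a < b) :
    ∃ x t : ℝ, 0 < t ∧ generatingCurve (catInterval m a) (catProfile m a) ∩
      generatingCurve (catInterval m b) (catProfile m b) = {(x, t), (x, -t)} := by
  have hb := ha.trans hab
  obtain ⟨ρ, hρ, he⟩ := exists_crossing hm ha hab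
  have hmb := invTime_mem hm hb hρ.le
  have hma := invTime_mem hm ha (hab.trans hρ).le
  have hfb := catProfile_invTime hm hb hρ.le
  have hfa := catProfile_invTime hm ha (hab.trans hρ).le
  rw [he] at hmb hfb
  set t := invTime m a ρ with ht
  have ht0 : 0 < t := by
    rw [ht, invTime, ← catTime_zero m a]
    exact strictMono_catTime hm ha (Real.arcosh_pos (one_lt_sinhRatioPow hm ha (hab.trans hρ)))
  have hTa : t ∈ Ioo (-catHalf m a) (catHalf m a) := ⟨by linarith [hma.2], hma.2⟩
  have hTb : t ∈ Ioo (-catHalf m b) (catHalf m b) := ⟨by linarith [hmb.2], hmb.2⟩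
  have key : ∀ s ∈ Ico 0 (catHalf m a), s ∈ Ico 0 (catHalf m b) →
      catProfile m a s = catProfile m b s → s = t := by
    intro s hsa hsb hs
    have h1 := invTime_catProfile hm ha hsa
    have h2 := invTime_catProfile hm hb hsb
    rw [hs] at h1
    have h3 : catProfile m b s = ρ := (strictMonoOn_invTime_sub hm ha hab).injOn
      (le_catProfile hb s) hρ.le (by simp only [h1, h2, he, ← ht, sub_self])
    rw [← h1, h3]
  refine ⟨Real.tanh (ρ / 2), t, ht0, Subset.antisymm ?_ ?_⟩
  · rintro _ ⟨⟨s, hsa, rfl⟩, ⟨s', hsb, hs'⟩⟩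
    simp only [Prod.mk.injEq] at hs'
    obtain ⟨h1, rfl⟩ := hs'
    have h2 := tanh_half_inj.1 h1
    have hsa' : s' ∈ Ioo (-catHalf m a) (catHalf m a) := hsa
    have hsb' : s' ∈ Ioo (-catHalf m b) (catHalf m b) := hsb
    rcases le_total 0 s' with h0 | h0
    · have h3 := key s' ⟨h0, hsa'.2⟩ ⟨h0, hsb'.2⟩ h2.symm
      left
      simp only [h3, hfa]
    · have h3 := key (-s') ⟨by linarith, by linarith [hsa'.1]⟩ ⟨by linarith, by linarith [hsb'.1]⟩
        (by rw [catProfile_neg hm ha hsa', catProfile_neg hm hb hsb', h2])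
      right
      have h4 := catProfile_neg hm ha hsa'
      rw [h3, hfa] at h4
      simp only [mem_singleton_iff, ← h4, ← h3, neg_neg]
  · rintro _ (rfl | rfl)
    · exact ⟨⟨t, hTa, by simp [hfa]⟩, ⟨t, hTb, by simp [hfb]⟩⟩
    · exact ⟨⟨-t, ⟨by linarith [hTa.2], by linarith [hTa.1]⟩, by simp [catProfile_neg hm ha hTa, hfa]⟩,
        ⟨-t, ⟨by linarith [hTb.2], by linarith [hTb.1]⟩, by simp [catProfile_neg hm hb hTb, hfb]⟩⟩

end Height

/-! ### Rotation hypersurfaces as immersions -/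

noncomputable section Parametrization

variable {n : ℕ} [Fact (2 ≤ n)]

/-- The inverse of the preferred chart of the sphere at `v`, with values in the ambient space. It is
the inverse of a stereographic projection and is defined on the whole model space. -/
def sphereParam (v : UnitSphere n) (z : EuclideanSpace ℝ (Fin (n - 1))) :
    EuclideanSpace ℝ (Fin n) :=
  ((chartAt (EuclideanSpace ℝ (Fin (n - 1))) v).symm z : UnitSphere n)

/-- The coordinates of `v` in the preferred chart at `v`. -/
def sphereCenter (v : UnitSphere n) : EuclideanSpace ℝ (Fin (n - 1)) :=
  chartAt (EuclideanSpace ℝ (Fin (n - 1))) v v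

lemma norm_sphereParam (v : UnitSphere n) (z : EuclideanSpace ℝ (Fin (n - 1))) :
    ‖sphereParam v z‖ = 1 := norm_eq_of_mem_sphere _

lemma sphereParam_center (v : UnitSphere n) : sphereParam v (sphereCenter v) = v := by
  rw [sphereParam, sphereCenter,
    (chartAt (EuclideanSpace ℝ (Fin (n - 1))) v).left_inv (mem_chart_source _ v)]

lemma contDiff_sphereParam (v : UnitSphere n) : ContDiff ℝ ∞ (sphereParam v) := by
  let U := (OrthonormalBasis.fromOrthogonalSpanSingleton (𝕜 := ℝ) (n - 1)
    (ne_zero_of_mem_unit_sphere (-v))).repr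
  exact ((contDiff_stereoInvFunAux (v := ((-v : UnitSphere n) : EuclideanSpace ℝ (Fin n)))).comp
    (ℝ ∙ ((-v : UnitSphere n) : EuclideanSpace ℝ (Fin n)))ᗮ.subtypeL.contDiff).comp U.symm.contDiff

lemma mvfderiv_coe_sphere (v : UnitSphere n) :
    mvfderiv (𝓡 (n - 1)) ((↑) : UnitSphere n → EuclideanSpace ℝ (Fin n)) v =
    fderiv ℝ (sphereParam v) (sphereCenter v) := by
  rw [((contMDiff_coe_sphere (m := ∞) v).mdifferentiableAt (by simp)).mvfderiv]
  simp only [fderivWithin_univ, mfld_simps]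
  rfl

lemma injective_fderiv_sphereParam (v : UnitSphere n) :
    Function.Injective (fderiv ℝ (sphereParam v) (sphereCenter v)) := by
  rw [← mvfderiv_coe_sphere]
  exact injective_mvfderiv_subtypeVal_sphere v

lemma range_fderiv_sphereParam (v : UnitSphere n) :
    (fderiv ℝ (sphereParam v) (sphereCenter v)).range =
      (Submodule.span ℝ {(v : EuclideanSpace ℝ (Fin n))})ᗮ := by
  rw [← mvfderiv_coe_sphere]
  exact range_mvfderiv_subtypeVal v

/-- The rotation hypersurface of profile `f` in the preferred chart at a point over `v`. -/
def rotationLocal (v : UnitSphere n) (f : ℝ → ℝ) (y : ℝ × EuclideanSpace ℝ (Fin (n - 1))) :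
    Ambient n :=
  (Real.tanh (f y.1 / 2) • sphereParam v y.2, y.1)

variable {I : TopologicalSpace.Opens ℝ} {f : ℝ → ℝ}

lemma extChartAt_cylinder_self (p : I × UnitSphere n) :
    extChartAt (cylinderModel n) p p = ((p.1 : ℝ), sphereCenter p.2) := by
  rw [extChartAt_prod]
  rfl

lemma rotationParam_comp_extChartAt_symm (p : I × UnitSphere n) :
    rotationParam n I f ∘ (extChartAt (cylinderModel n) p).symm
      =ᶠ[𝓝 ((p.1 : ℝ), sphereCenter p.2)] rotationLocal p.2 f := by
  have h := TopologicalSpace.Opens.chartAt_subtype_val_symm_eventuallyEq (H := ℝ) I (x := p.1)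
  have h' : ∀ᶠ y : ℝ × EuclideanSpace ℝ (Fin (n - 1)) in 𝓝 ((p.1 : ℝ), sphereCenter p.2),
      y.1 = ((chartAt ℝ p.1).symm y.1 : I) :=
    (continuous_fst.tendsto ((p.1 : ℝ), sphereCenter p.2)).eventually h
  filter_upwards [h'] with y hy
  have he : (extChartAt (cylinderModel n) p).symm y =
      ((chartAt ℝ p.1).symm y.1, (chartAt (EuclideanSpace ℝ (Fin (n - 1))) p.2).symm y.2) := by
    rw [extChartAt_prod]
    rfl
  simp only [Function.comp_apply, he, rotationParam, rotationLocal, sphereParam, ← hy]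

lemma hasFDerivAt_rotationLocal (v : UnitSphere n) {y : ℝ × EuclideanSpace ℝ (Fin (n - 1))}
    {r' : ℝ} (hr : HasDerivAt (fun s => Real.tanh (f s / 2)) r' y.1) :
    HasFDerivAt (rotationLocal v f)
      ((Real.tanh (f y.1 / 2) • (fderiv ℝ (sphereParam v) y.2 ∘L
            ContinuousLinearMap.snd ℝ ℝ (EuclideanSpace ℝ (Fin (n - 1)))) +
          (r' • ContinuousLinearMap.fst ℝ ℝ (EuclideanSpace ℝ (Fin (n - 1)))).smulRight
            (sphereParam v y.2)).prod
        (ContinuousLinearMap.fst ℝ ℝ (EuclideanSpace ℝ (Fin (n - 1))))) y := by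
  have h1 : HasFDerivAt (fun y : ℝ × EuclideanSpace ℝ (Fin (n - 1)) => Real.tanh (f y.1 / 2))
      (r' • ContinuousLinearMap.fst ℝ ℝ (EuclideanSpace ℝ (Fin (n - 1)))) y :=
    hr.comp_hasFDerivAt y hasFDerivAt_fst
  have h2 : HasFDerivAt (fun y : ℝ × EuclideanSpace ℝ (Fin (n - 1)) => sphereParam v y.2)
      (fderiv ℝ (sphereParam v) y.2 ∘L
            ContinuousLinearMap.snd ℝ ℝ (EuclideanSpace ℝ (Fin (n - 1)))) y :=
    (((contDiff_sphereParam v).differentiable (by simp)) y.2).hasFDerivAt.comp y hasFDerivAt_snd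
  exact (h1.smul h2).prodMk hasFDerivAt_fst

lemma fderiv_rotationLocal (v : UnitSphere n) {y : ℝ × EuclideanSpace ℝ (Fin (n - 1))}
    {r' : ℝ} (hr : HasDerivAt (fun s => Real.tanh (f s / 2)) r' y.1)
    (u : ℝ × EuclideanSpace ℝ (Fin (n - 1))) :
    fderiv ℝ (rotationLocal v f) y u =
      (Real.tanh (f y.1 / 2) • fderiv ℝ (sphereParam v) y.2 u.2 +
        (r' * u.1) • sphereParam v y.2, u.1) := by
  rw [(hasFDerivAt_rotationLocal v hr).fderiv]
  simp

lemma hasDerivAt_tanh_half {s f' : ℝ} (hf : HasDerivAt f f' s) :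
    HasDerivAt (fun s => Real.tanh (f s / 2)) ((1 - Real.tanh (f s / 2) ^ 2) / 2 * f') s := by
  refine ((hasDerivAt_tanh _).comp s (hf.div_const 2)).congr_deriv ?_
  ring

lemma tanh_half_pos {x : ℝ} (hx : 0 < x) : 0 < Real.tanh (x / 2) := by
  rw [← Real.tanh_zero]
  exact strictMono_tanh (by linarith)

lemma contMDiff_rotationParam (hf : ∀ t ∈ I, ContDiffAt ℝ ∞ f t) :
    ContMDiff (cylinderModel n) 𝓘(ℝ, Ambient n) ∞ (rotationParam n I f) := by
  have hfst : ContMDiff (cylinderModel n) 𝓘(ℝ, ℝ) ∞ fun p : I × UnitSphere n => (p.1 : ℝ) :=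
    contMDiff_subtype_val.comp contMDiff_fst
  have hsnd : ContMDiff (cylinderModel n) 𝓘(ℝ, EuclideanSpace ℝ (Fin n)) ∞
      fun p : I × UnitSphere n => (p.2 : EuclideanSpace ℝ (Fin n)) :=
    contMDiff_coe_sphere.comp contMDiff_snd
  have hr : ContMDiff (cylinderModel n) 𝓘(ℝ, ℝ) ∞
      fun p : I × UnitSphere n => Real.tanh (f p.1 / 2) := by
    intro p
    have h1 : ContDiffAt ℝ ∞ (fun s => Real.tanh (f s / 2)) (p.1 : ℝ) :=
      contDiff_tanh.contDiffAt.comp _ ((hf _ p.1.2).div_const 2)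
    exact ContMDiffAt.comp (g := fun s => Real.tanh (f s / 2)) p h1.contMDiffAt (hfst p)
  exact (hr.smul hsnd).prodMk_space hfst

lemma mfderiv_rotationParam (hf : ∀ t ∈ I, ContDiffAt ℝ ∞ f t) (p : I × UnitSphere n) :
    mfderiv (cylinderModel n) 𝓘(ℝ, Ambient n) (rotationParam n I f) p =
      fderiv ℝ (rotationLocal p.2 f) ((p.1 : ℝ), sphereCenter p.2) := by
  rw [((contMDiff_rotationParam hf p).mdifferentiableAt (by simp)).mfderiv,
    extChartAt_cylinder_self]
  rw [ModelWithCorners.range_eq_univ, fderivWithin_univ]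
  exact (rotationParam_comp_extChartAt_symm p).fderiv_eq

lemma isSmoothImmersionInto_rotationParam (hf : ∀ t ∈ I, ContDiffAt ℝ ∞ f t)
    (hpos : ∀ t ∈ I, 0 < f t) :
    IsSmoothImmersionInto (cylinderModel n) (hypProd n) (rotationParam n I f) := by
  refine ⟨fun p => ?_, contMDiff_rotationParam hf, fun p => ?_⟩
  · have h1 := tanh_half_pos (hpos _ p.1.2)
    have h2 := Real.tanh_lt_one (f p.1 / 2)
    simpa [hypProd, rotationParam, norm_smul, abs_of_pos h1] using h2
  · rw [mfderiv_rotationParam hf]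
    have hd := hasDerivAt_tanh_half ((hf _ p.1.2).differentiableAt (by simp)).hasDerivAt
    refine (injective_iff_map_eq_zero
      (fderiv ℝ (rotationLocal p.2 f) ((p.1 : ℝ), sphereCenter p.2))).2 fun u hu => ?_
    rw [fderiv_rotationLocal p.2 hd, Prod.mk_eq_zero] at hu
    obtain ⟨hu1, hu2⟩ := hu
    simp only [hu2, mul_zero, zero_smul, add_zero] at hu1
    have hu3 := (smul_eq_zero.1 hu1).resolve_left (tanh_half_pos (hpos _ p.1.2)).ne'
    have hu4 := (injective_iff_map_eq_zero _).1 (injective_fderiv_sphereParam p.2) _ hu3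
    exact Prod.ext hu2 hu4

end Parametrization

/-! ### Mean curvature of rotation hypersurfaces -/

noncomputable section Minimality

variable {n : ℕ}

/-- The mean curvature depends only on the germ of the parametrization. -/
lemma ZeroMeanCurvatureAt.congr {F W : Type*} [NormedAddCommGroup F] [NormedSpace ℝ F]
    [NormedAddCommGroup W] [NormedSpace ℝ W] {g : F → F → F → ℝ} {φ ψ : W → F} {y : W}
    (h : ZeroMeanCurvatureAt g ψ y) (hφ : φ =ᶠ[𝓝 y] ψ) : ZeroMeanCurvatureAt g φ y := by
  have h2 : ∀ v, fderiv ℝ (fun z => fderiv ℝ φ z v) y = fderiv ℝ (fun z => fderiv ℝ ψ z v) y :=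
    fun v => (hφ.fderiv.fun_comp fun L : W →L[ℝ] F => L v).fderiv_eq
  intro ν e hν he
  simp only [secondFundForm, hφ.eq_of_nhds, hφ.fderiv_eq, h2] at hν he ⊢
  exact h ν e hν he

/-- Parseval's identity. No definiteness is assumed: an orthonormal family with the right number of
elements is a basis. -/
lemma bilinForm_self_eq_sum_sq {V : Type*} [AddCommGroup V] [Module ℝ V] [FiniteDimensional ℝ V]
    (B : LinearMap.BilinForm ℝ V) (e : Fin (Module.finrank ℝ V) → V)
    (he : ∀ i j, B (e i) (e j) = if i = j then 1 else 0) (x : V) :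
    B x x = ∑ i, B x (e i) ^ 2 := by
  have hcoeff : ∀ (c : Fin (Module.finrank ℝ V) → ℝ) j, B (∑ i, c i • e i) (e j) = c j := by
    intro c j
    simp [map_sum, LinearMap.sum_apply, he]
  have hli : LinearIndependent ℝ e := by
    refine Fintype.linearIndependent_iff.2 fun c hc j => ?_
    rw [← hcoeff c j, hc, map_zero, LinearMap.zero_apply]
  have hx : x ∈ Submodule.span ℝ (range e) := by
    rw [hli.span_eq_top_of_card_eq_finrank' (by simp)]
    trivial
  obtain ⟨c, rfl⟩ := (Submodule.mem_span_range_iff_exists_fun ℝ).1 hx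
  conv_lhs => rw [map_sum]
  refine Finset.sum_congr rfl fun j _ => ?_
  rw [map_smul, hcoeff, smul_eq_mul, sq]

lemma fderiv_hypProdMetric {p : Ambient n} (hp : ‖p.1‖ < 1) (v w u : Ambient n) :
    fderiv ℝ (fun q => hypProdMetric n q v w) p u =
      2 * (2 / (1 - ‖p.1‖ ^ 2)) ^ 3 * inner ℝ p.1 u.1 * inner ℝ v.1 w.1 := by
  have h1 : HasFDerivAt (fun q : Ambient n => ‖q.1‖ ^ 2) _ p :=
    (hasStrictFDerivAt_norm_sq p.1).hasFDerivAt.comp p hasFDerivAt_fst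
  have hne : 1 - ‖p.1‖ ^ 2 ≠ 0 := by nlinarith [norm_nonneg p.1]
  have h2 : HasDerivAt (fun x : ℝ => (2 / (1 - x)) ^ 2 * inner ℝ v.1 w.1 + v.2 * w.2)
      ((2 / (1 - ‖p.1‖ ^ 2)) ^ 3 * inner ℝ v.1 w.1) (‖p.1‖ ^ 2) := by
    have h3 := (((((hasDerivAt_id (‖p.1‖ ^ 2)).const_sub 1).fun_inv hne).const_mul 2).fun_pow 2
      |>.mul_const (inner ℝ v.1 w.1)).add_const (v.2 * w.2)
    refine HasDerivAt.congr_deriv (f := fun x : ℝ => (2 / (1 - x)) ^ 2 * inner ℝ v.1 w.1 + v.2 * w.2)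
      h3 ?_
    simp only [id, Nat.add_one_sub_one, pow_one, Nat.cast_ofNat]
    field_simp
  have h4 := h2.comp_hasFDerivAt p h1
  have h5 : (fun q => hypProdMetric n q v w) =
      (fun x : ℝ => (2 / (1 - x)) ^ 2 * inner ℝ v.1 w.1 + v.2 * w.2) ∘
        fun q : Ambient n => ‖q.1‖ ^ 2 := rfl
  rw [h5, h4.fderiv]
  simp
  ring

lemma christoffelFirst_hypProdMetric {p : Ambient n} (hp : ‖p.1‖ < 1) (u v w : Ambient n) :
    christoffelFirst (hypProdMetric n) p u v w = (2 / (1 - ‖p.1‖ ^ 2)) ^ 3 *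
      (inner ℝ p.1 u.1 * inner ℝ v.1 w.1 + inner ℝ p.1 v.1 * inner ℝ u.1 w.1
        - inner ℝ p.1 w.1 * inner ℝ u.1 v.1) := by
  rw [christoffelFirst, fderiv_hypProdMetric hp, fderiv_hypProdMetric hp, fderiv_hypProdMetric hp]
  ring

variable [Fact (2 ≤ n)]

lemma inner_sphereParam_self (v : UnitSphere n) (z : EuclideanSpace ℝ (Fin (n - 1))) :
    inner ℝ (sphereParam v z) (sphereParam v z) = 1 := by
  rw [real_inner_self_eq_norm_sq, norm_sphereParam, one_pow]

lemma hasFDerivAt_sphereParam (v : UnitSphere n) (z : EuclideanSpace ℝ (Fin (n - 1))) :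
    HasFDerivAt (sphereParam v) (fderiv ℝ (sphereParam v) z) z :=
  ((contDiff_sphereParam v).differentiable (by simp) z).hasFDerivAt

lemma inner_fderiv_sphereParam (v : UnitSphere n) (z ζ : EuclideanSpace ℝ (Fin (n - 1))) :
    inner ℝ (sphereParam v z) (fderiv ℝ (sphereParam v) z ζ) = 0 := by
  have h := ((hasFDerivAt_sphereParam v z).inner ℝ (hasFDerivAt_sphereParam v z)).unique
    ((hasFDerivAt_const (1 : ℝ) z).congr_of_eventuallyEq
      (Eventually.of_forall fun z => inner_sphereParam_self v z))
  have h2 := congrArg (fun L => L ζ) h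
  simp [fderivInnerCLM_apply] at h2
  have h3 := real_inner_comm (sphereParam v z) (fderiv ℝ (sphereParam v) z ζ)
  linarith

lemma hasFDerivAt_fderiv_sphereParam (v : UnitSphere n) (z ζ : EuclideanSpace ℝ (Fin (n - 1))) :
    HasFDerivAt (fun z => fderiv ℝ (sphereParam v) z ζ)
      (fderiv ℝ (fun z => fderiv ℝ (sphereParam v) z ζ) z) z := by
  have h : ContDiff ℝ ∞ (fun z => fderiv ℝ (sphereParam v) z ζ) :=
    (contDiff_infty_iff_fderiv.1 (contDiff_sphereParam v)).2.clm_apply contDiff_const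
  exact (h.differentiable (by simp) z).hasFDerivAt

/-- The second fundamental form of the unit sphere in the direction of the position vector. -/
lemma inner_second_fderiv_sphereParam (v : UnitSphere n)
    (z ζ : EuclideanSpace ℝ (Fin (n - 1))) :
    inner ℝ (sphereParam v z) (fderiv ℝ (fun z => fderiv ℝ (sphereParam v) z ζ) z ζ) =
      -‖fderiv ℝ (sphereParam v) z ζ‖ ^ 2 := by
  have h := ((hasFDerivAt_sphereParam v z).inner ℝ (hasFDerivAt_fderiv_sphereParam v z ζ)).unique
    ((hasFDerivAt_const (0 : ℝ) z).congr_of_eventuallyEq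
      (Eventually.of_forall fun z => inner_fderiv_sphereParam v z ζ))
  have h2 := congrArg (fun L => L ζ) h
  simp [fderivInnerCLM_apply] at h2
  linarith

lemma second_fderiv_rotationLocal {f : ℝ → ℝ} (v : UnitSphere n)
    {y : ℝ × EuclideanSpace ℝ (Fin (n - 1))} {r' : ℝ → ℝ} {r'' : ℝ}
    (hr : ∀ᶠ s in 𝓝 y.1, HasDerivAt (fun s => Real.tanh (f s / 2)) (r' s) s)
    (hr' : HasDerivAt r' r'' y.1) (u : ℝ × EuclideanSpace ℝ (Fin (n - 1))) :
    fderiv ℝ (fun z => fderiv ℝ (rotationLocal v f) z u) y u =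
      (Real.tanh (f y.1 / 2) • fderiv ℝ (fun z => fderiv ℝ (sphereParam v) z u.2) y.2 u.2 +
        (2 * r' y.1 * u.1) • fderiv ℝ (sphereParam v) y.2 u.2 +
        (r'' * u.1 ^ 2) • sphereParam v y.2, 0) := by
  have h1 : (fun z => fderiv ℝ (rotationLocal v f) z u) =ᶠ[𝓝 y] fun z =>
      (Real.tanh (f z.1 / 2) • fderiv ℝ (sphereParam v) z.2 u.2 +
        (r' z.1 * u.1) • sphereParam v z.2, u.1) := by
    filter_upwards [(continuous_fst.tendsto y).eventually hr] with z hz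
    exact fderiv_rotationLocal v hz u
  have hfst : HasFDerivAt Prod.fst
    (ContinuousLinearMap.fst ℝ ℝ (EuclideanSpace ℝ (Fin (n - 1)))) y := hasFDerivAt_fst
  have hsnd : HasFDerivAt Prod.snd
    (ContinuousLinearMap.snd ℝ ℝ (EuclideanSpace ℝ (Fin (n - 1)))) y := hasFDerivAt_snd
  have h2 := hr.self_of_nhds.comp_hasFDerivAt y hfst
  have h3 := (hasFDerivAt_fderiv_sphereParam v y.2 u.2).comp y hsnd
  have h4 := (hr'.comp_hasFDerivAt y hfst).mul_const u.1
  have h5 := (hasFDerivAt_sphereParam v y.2).comp y hsnd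
  have h6 := ((h2.smul h3).add (h4.smul h5)).prodMk (hasFDerivAt_const u.1 y)
  rw [h1.fderiv_eq]
  have h7 := congrArg (fun L => L u) h6.fderiv
  refine Eq.trans h7 ?_
  simp
  module

lemma cosh_div_sinh_eq {x : ℝ} (hx : 0 < x) :
    Real.cosh x / Real.sinh x =
      (1 + Real.tanh (x / 2) ^ 2) / (2 * Real.tanh (x / 2)) := by
  have h1 := Real.cosh_pos (x / 2)
  have h2 := Real.sinh_pos_iff.2 (half_pos hx)
  have h3 : x = 2 * (x / 2) := by ring
  conv_lhs => rw [h3, Real.cosh_two_mul, Real.sinh_two_mul]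
  rw [Real.tanh_eq_sinh_div_cosh]
  field_simp

/-- A vector normal to the unit sphere is radial. -/
lemma exists_smul_of_inner_fderiv_sphereParam (v : UnitSphere n) (x : EuclideanSpace ℝ (Fin n))
    (h : ∀ ζ, inner ℝ (fderiv ℝ (sphereParam v) (sphereCenter v) ζ) x = 0) :
    ∃ κ : ℝ, x = κ • sphereParam v (sphereCenter v) := by
  have h1 : x ∈ ((fderiv ℝ (sphereParam v) (sphereCenter v)).range)ᗮ := by
    rw [Submodule.mem_orthogonal]
    rintro _ ⟨ζ, rfl⟩
    exact h ζ
  rw [range_fderiv_sphereParam, Submodule.orthogonal_orthogonal,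
    Submodule.mem_span_singleton] at h1
  obtain ⟨κ, hκ⟩ := h1
  exact ⟨κ, by rw [sphereParam_center, hκ]⟩

/-- The metric induced on the parameters of the rotation hypersurface. -/
lemma hypProdMetric_fderiv_rotationLocal {f : ℝ → ℝ} (v : UnitSphere n)
    {y : ℝ × EuclideanSpace ℝ (Fin (n - 1))} {r' : ℝ}
    (hr : HasDerivAt (fun s => Real.tanh (f s / 2)) r' y.1)
    (u w : ℝ × EuclideanSpace ℝ (Fin (n - 1))) :
    hypProdMetric n (rotationLocal v f y) (fderiv ℝ (rotationLocal v f) y u)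
        (fderiv ℝ (rotationLocal v f) y w) =
      (2 / (1 - Real.tanh (f y.1 / 2) ^ 2)) ^ 2 * (Real.tanh (f y.1 / 2) ^ 2 *
        inner ℝ (fderiv ℝ (sphereParam v) y.2 u.2) (fderiv ℝ (sphereParam v) y.2 w.2)
        + r' ^ 2 * u.1 * w.1) + u.1 * w.1 := by
  rw [fderiv_rotationLocal v hr, fderiv_rotationLocal v hr, hypProdMetric]
  have h1 := inner_sphereParam_self v y.2
  have h2 := inner_fderiv_sphereParam v y.2
  have h3 : ∀ ζ, inner ℝ (fderiv ℝ (sphereParam v) y.2 ζ) (sphereParam v y.2) = 0 := fun ζ => by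
    rw [real_inner_comm, h2]
  have h4 : ‖(rotationLocal v f y).1‖ ^ 2 = Real.tanh (f y.1 / 2) ^ 2 := by
    simp [rotationLocal, norm_smul, norm_sphereParam]
  rw [h4]
  simp only [inner_add_left, inner_add_right, real_inner_smul_left, real_inner_smul_right, h1, h2,
    h3]
  ring

/-- The second fundamental form of the rotation hypersurface in a normal direction `ν`, whose
horizontal part is radial. Here `r` is the Euclidean radius and `c` the conformal factor there. -/
lemma secondFundForm_rotationLocal {f : ℝ → ℝ} (v : UnitSphere n)
    {y : ℝ × EuclideanSpace ℝ (Fin (n - 1))} {r' : ℝ → ℝ} {r'' : ℝ}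
    (hr : ∀ᶠ s in 𝓝 y.1, HasDerivAt (fun s => Real.tanh (f s / 2)) (r' s) s)
    (hr' : HasDerivAt r' r'' y.1) {ν : Ambient n} {κ : ℝ} (hν : ν.1 = κ • sphereParam v y.2)
    (u : ℝ × EuclideanSpace ℝ (Fin (n - 1))) {r c : ℝ} (hr0 : Real.tanh (f y.1 / 2) = r)
    (hc : 2 / (1 - r ^ 2) = c) :
    secondFundForm (hypProdMetric n) (rotationLocal v f) y ν u u =
      c ^ 2 * κ * ((r'' + c * r * r' y.1 ^ 2) * u.1 ^ 2
        - r * (1 + c * r ^ 2) * ‖fderiv ℝ (sphereParam v) y.2 u.2‖ ^ 2) := by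
  have h1 := inner_sphereParam_self v y.2
  have h2 := inner_fderiv_sphereParam v y.2
  have h3 : ∀ ζ, inner ℝ (fderiv ℝ (sphereParam v) y.2 ζ) (sphereParam v y.2) = 0 := fun ζ => by
    rw [real_inner_comm, h2]
  have h5 := inner_second_fderiv_sphereParam v y.2 u.2
  rw [real_inner_comm] at h5
  have h4 : ‖(rotationLocal v f y).1‖ = |r| := by
    simp [rotationLocal, norm_smul, norm_sphereParam, hr0]
  have h6 : ‖(rotationLocal v f y).1‖ < 1 := by
    rw [h4, ← hr0, abs_lt]
    exact ⟨Real.neg_one_lt_tanh _, Real.tanh_lt_one _⟩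
  have h7 : (rotationLocal v f y).1 = r • sphereParam v y.2 := by rw [← hr0]; rfl
  rw [secondFundForm, christoffelFirst_hypProdMetric h6, hypProdMetric,
    second_fderiv_rotationLocal v hr hr', fderiv_rotationLocal v hr.self_of_nhds, h4, sq_abs, hc,
    h7, hν, hr0]
  simp only [inner_add_left, inner_add_right, real_inner_smul_left, real_inner_smul_right, h1, h2,
    h3, h5, real_inner_self_eq_norm_sq (fderiv ℝ (sphereParam v) y.2 u.2)]
  ring

/-- The catenary equation is the minimality of the rotation hypersurface. In terms of the sum `P` of
the squared vertical components and the sum `Q` of the squared spherical components of an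
orthonormal basis, the trace of the second fundamental form is a combination of `P` and `Q`; the
values of `P` and `Q` come from Parseval's identity for the parameter vector `(1, 0)` and from the
dimension. -/
lemma zeroMeanCurvatureAt_rotationLocal {f : ℝ → ℝ} (v : UnitSphere n) {s : ℝ} (hpos : 0 < f s)
    (hf : ∀ᶠ t in 𝓝 s, DifferentiableAt ℝ f t)
    (hode : HasDerivAt (deriv f)
      (((n : ℝ) - 1) * (Real.cosh (f s) / Real.sinh (f s)) * (1 + deriv f s ^ 2)) s) :
    ZeroMeanCurvatureAt (hypProdMetric n) (rotationLocal v f) (s, sphereCenter v) := by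
  intro ν e hν he
  set y : ℝ × EuclideanSpace ℝ (Fin (n - 1)) := (s, sphereCenter v) with hy
  set r' : ℝ → ℝ := fun t => (1 - Real.tanh (f t / 2) ^ 2) / 2 * deriv f t with hr'def
  have hr : ∀ᶠ t in 𝓝 y.1, HasDerivAt (fun s => Real.tanh (f s / 2)) (r' t) t := by
    filter_upwards [hf] with t ht using hasDerivAt_tanh_half ht.hasDerivAt
  set f1 := deriv f s with hf1
  set f2 := ((n : ℝ) - 1) * (Real.cosh (f s) / Real.sinh (f s)) * (1 + f1 ^ 2) with hf2
  obtain ⟨r, hr0⟩ : ∃ r, Real.tanh (f s / 2) = r := ⟨_, rfl⟩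
  obtain ⟨c, hc⟩ : ∃ c, 2 / (1 - r ^ 2) = c := ⟨_, rfl⟩
  have hrpos : 0 < r := hr0 ▸ tanh_half_pos hpos
  have hrlt : r < 1 := hr0 ▸ Real.tanh_lt_one _
  have hd : 0 < 1 - r ^ 2 := by nlinarith
  have hcpos : 0 < c := by rw [← hc]; positivity
  have hr1 : r' s = f1 / c := by
    simp only [hr'def, hr0, ← hc, ← hf1]
    field_simp
  have hr' : HasDerivAt r' (-(r * (f1 / c)) * f1 + f2 / c) y.1 := by
    have h := (((hr.self_of_nhds.fun_pow 2).const_sub 1).div_const 2).fun_mul hode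
    refine h.congr_deriv ?_
    simp only [hy, hr0, hr1, ← hf1, ← hc]
    field_simp
    ring
  -- normal vectors are radial in the first factor
  obtain ⟨κ, hκ⟩ := exists_smul_of_inner_fderiv_sphereParam v ν.1 fun ζ => by
    have h := hν (0, ζ)
    rw [fderiv_rotationLocal v hr.self_of_nhds, hypProdMetric] at h
    have h4 : ‖(rotationLocal v f y).1‖ ^ 2 = r ^ 2 := by
      simp [rotationLocal, norm_smul, norm_sphereParam, hy, hr0]
    rw [h4, hc] at h
    simp only [mul_zero, zero_smul, add_zero, zero_mul, real_inner_smul_left, hy, hr0] at h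
    simpa [hcpos.ne', hrpos.ne'] using h
  have hII := fun u => secondFundForm_rotationLocal v hr hr' hκ u hr0 hc
  have hG := hypProdMetric_fderiv_rotationLocal v hr.self_of_nhds
  simp only [show y.1 = s from rfl, hr0, hc, hr1] at hG hII
  simp only [hII, ← Finset.mul_sum, Finset.sum_sub_distrib]
  -- Parseval's identity for `∂/∂t` in the given orthonormal basis
  let B : LinearMap.BilinForm ℝ (ℝ × EuclideanSpace ℝ (Fin (n - 1))) :=
    LinearMap.mk₂ ℝ (fun u w => hypProdMetric n (rotationLocal v f y)
        (fderiv ℝ (rotationLocal v f) y u) (fderiv ℝ (rotationLocal v f) y w))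
      (fun _ _ _ => by simp [hypProdMetric, inner_add_left]; ring)
      (fun _ _ _ => by simp [hypProdMetric, real_inner_smul_left]; ring)
      (fun _ _ _ => by simp [hypProdMetric, inner_add_right]; ring)
      (fun _ _ _ => by simp [hypProdMetric, real_inner_smul_right]; ring)
  have hP := bilinForm_self_eq_sum_sq B e he (1, 0)
  have hB : ∀ u, B (1, 0) u = (1 + f1 ^ 2) * u.1 := fun u => by
    refine (hG (1, 0) u).trans ?_
    simp only [map_zero, inner_zero_left]
    field_simp
    ring
  simp only [hB, mul_one, mul_pow, ← Finset.mul_sum] at hP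
  set P := ∑ i, (e i).1 ^ 2 with hPdef
  set Q := ∑ i, ‖fderiv ℝ (sphereParam v) y.2 (e i).2‖ ^ 2 with hQdef
  have hP' : (1 + f1 ^ 2) * P = 1 := by
    have h1 : 0 < 1 + f1 ^ 2 := by positivity
    refine mul_left_cancel₀ h1.ne' ?_
    linarith
  have hn : ((Module.finrank ℝ (ℝ × EuclideanSpace ℝ (Fin (n - 1))) : ℕ) : ℝ) = n := by
    have := (Fact.out : 2 ≤ n)
    rw [Module.finrank_prod, finrank_euclideanSpace_fin, Module.finrank_self]
    congr 1
    omega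
  have hQ : c ^ 2 * r ^ 2 * Q + (1 + f1 ^ 2) * P = n := by
    have h : ∑ i, (c ^ 2 * r ^ 2 * ‖fderiv ℝ (sphereParam v) y.2 (e i).2‖ ^ 2 +
        (1 + f1 ^ 2) * (e i).1 ^ 2) =
        ∑ i : Fin (Module.finrank ℝ (ℝ × EuclideanSpace ℝ (Fin (n - 1)))), (1 : ℝ) := by
      refine Finset.sum_congr rfl fun i _ => ?_
      have h1 := he i i
      rw [if_pos rfl, hG, real_inner_self_eq_norm_sq] at h1
      refine Eq.trans ?_ h1
      field_simp
      ring
    rw [Finset.sum_add_distrib, ← Finset.mul_sum, ← Finset.mul_sum, Finset.sum_const,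
      Finset.card_univ, Fintype.card_fin, nsmul_one, hn] at h
    exact h
  have hQ' : Q = ((n : ℝ) - 1) / (c ^ 2 * r ^ 2) := by
    rw [eq_div_iff (by positivity)]
    linarith
  have hP'' : P = 1 / (1 + f1 ^ 2) := by
    rw [eq_div_iff (by positivity)]
    linarith
  rw [hQ', hP'', hf2, cosh_div_sinh_eq hpos, hr0, ← hc]
  field_simp
  ring

end Minimality

/-! ### Completeness -/

noncomputable section Completeness

section General

variable {F : Type*} [NormedAddCommGroup F] [NormedSpace ℝ F]
  {W : Type*} [NormedAddCommGroup W] [NormedSpace ℝ W]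
  {H : Type*} [TopologicalSpace H] {J : ModelWithCorners ℝ W H}
  {M : Type*} [TopologicalSpace M] [ChartedSpace H M]
  {E : Type*} [NormedAddCommGroup E] [NormedSpace ℝ E]

/-- A map whose differential is bounded by the metric `g` along `X` is 1-Lipschitz for the distance
induced by `X`. -/
lemma edist_le_inducedEDist {g : F → F → F → ℝ} {X : M → F} (hX : ContMDiff J 𝓘(ℝ, F) 1 X)
    {P : F → E} (hP : ∀ p, ContDiffAt ℝ 1 P (X p))
    (hg : ∀ p v, ‖fderiv ℝ P (X p) v‖ ≤ √(g (X p) v v)) (p q : M) :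
    edist (P (X p)) (P (X q)) ≤ inducedEDist J g X p q := by
  let _ : ∀ x : M, ENorm (TangentSpace J x) := fun x =>
    ⟨fun v => ENNReal.ofReal
      (√(g (X x) (mfderiv J 𝓘(ℝ, F) X x v) (mfderiv J 𝓘(ℝ, F) X x v)))⟩
  change _ ≤ Manifold.riemannianEDist J p q
  simp only [riemannianEDist, le_iInf_iff]
  intro γ hγ
  have hPX : ContMDiff J 𝓘(ℝ, E) 1 (P ∘ X) := fun x => (hP x).contMDiffAt.comp x (hX x)
  let γ' : ℝ → M := γ ∘ projIcc 0 1 zero_le_one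
  have hγ' : ContMDiffOn 𝓘(ℝ, ℝ) J 1 γ' (Icc 0 1) := hγ.comp_contMDiffOn contMDiffOn_projIcc
  let e : ℝ → E := (P ∘ X) ∘ γ'
  have D : ContDiffOn ℝ 1 e (Icc 0 1) := contMDiffOn_iff_contDiffOn.mp (hPX.comp_contMDiffOn hγ')
  rw [lintegral_norm_mfderiv_Icc_eq_pathELength_projIcc,
    pathELength_eq_lintegral_mfderivWithin_Icc, edist_comm, edist_eq_enorm_sub,
    show P (X p) = e 0 by simp [e, γ'], show P (X q) = e 1 by simp [e, γ']]
  refine (enorm_sub_le_lintegral_derivWithin_Icc_of_contDiffOn_Icc D zero_le_one).trans ?_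
  refine setLIntegral_mono' measurableSet_Icc fun t ht => ?_
  have h1 : HasMFDerivWithinAt 𝓘(ℝ, ℝ) J γ' (Icc 0 1) t (mfderivWithin 𝓘(ℝ, ℝ) J γ' (Icc 0 1) t) :=
    (hγ'.mdifferentiableOn one_ne_zero t ht).hasMFDerivWithinAt
  have h2 : HasMFDerivAt J 𝓘(ℝ, F) X (γ' t) (mfderiv J 𝓘(ℝ, F) X (γ' t)) :=
    (hX.mdifferentiableAt one_ne_zero).hasMFDerivAt
  have h3 : HasMFDerivAt 𝓘(ℝ, F) 𝓘(ℝ, E) P (X (γ' t)) (fderiv ℝ P (X (γ' t))) :=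
    ((hP (γ' t)).differentiableAt one_ne_zero).hasFDerivAt.hasMFDerivAt
  obtain ⟨L, hL, h4⟩ : ∃ L : ℝ →L[ℝ] E, L 1 = fderiv ℝ P (X (γ' t))
      (mfderiv J 𝓘(ℝ, F) X (γ' t) (mfderivWithin 𝓘(ℝ, ℝ) J γ' (Icc 0 1) t 1)) ∧
      HasFDerivWithinAt e L (Icc 0 1) t :=
    ⟨_, rfl, hasMFDerivWithinAt_iff_hasFDerivWithinAt.1
      ((h3.comp (γ' t) h2).comp_hasMFDerivWithinAt t h1)⟩
  have h5 : derivWithin e (Icc 0 1) t = L 1 := by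
    rw [← fderivWithin_derivWithin, h4.fderivWithin (uniqueDiffOn_Icc zero_lt_one t ht)]
  rw [h5, hL, ← ofReal_norm]
  exact ENNReal.ofReal_le_ofReal (hg (γ' t) _)

end General

/-- The hyperbolic distance of the first component to the origin. -/
def axisDist {n : ℕ} (q : Ambient n) : ℝ := Real.log (1 + ‖q.1‖) - Real.log (1 - ‖q.1‖)

variable {n : ℕ}

lemma log_tanh_half (x : ℝ) :
    Real.log (1 + Real.tanh (x / 2)) - Real.log (1 - Real.tanh (x / 2)) = x := by
  have h1 := Real.neg_one_lt_tanh (x / 2)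
  have h2 := Real.tanh_lt_one (x / 2)
  rw [← Real.log_div (by linarith) (by linarith)]
  have h := Real.artanh_eq_half_log (x := Real.tanh (x / 2)) ⟨h1.le, h2.le⟩
  rw [Real.artanh_tanh] at h
  linarith

lemma one_le_conformal {x : EuclideanSpace ℝ (Fin n)} (hx : ‖x‖ < 1) : 1 ≤ 2 / (1 - ‖x‖ ^ 2) := by
  have h : 0 < 1 - ‖x‖ ^ 2 := by nlinarith [norm_nonneg x]
  rw [le_div_iff₀ h]
  nlinarith [sq_nonneg ‖x‖]

lemma conformal_mul_norm_le (q v : Ambient n) :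
    2 / (1 - ‖q.1‖ ^ 2) * ‖v.1‖ ≤ √(hypProdMetric n q v v) := by
  apply Real.le_sqrt_of_sq_le
  rw [hypProdMetric, real_inner_self_eq_norm_sq, mul_pow]
  nlinarith [sq_nonneg v.2]

lemma norm_fst_le_hypProdMetric {q : Ambient n} (v : Ambient n) (hq : ‖q.1‖ < 1) :
    ‖v.1‖ ≤ √(hypProdMetric n q v v) :=
  (le_mul_of_one_le_left (norm_nonneg _) (one_le_conformal hq)).trans (conformal_mul_norm_le q v)

lemma norm_snd_le_hypProdMetric (q v : Ambient n) : ‖v.2‖ ≤ √(hypProdMetric n q v v) := by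
  apply Real.le_sqrt_of_sq_le
  rw [hypProdMetric, real_inner_self_eq_norm_sq, Real.norm_eq_abs, sq_abs]
  nlinarith [mul_nonneg (sq_nonneg (2 / (1 - ‖q.1‖ ^ 2))) (sq_nonneg ‖v.1‖)]

lemma contDiffAt_axisDist {q : Ambient n} (hq0 : q.1 ≠ 0) (hq : ‖q.1‖ < 1) :
    ContDiffAt ℝ 1 axisDist q := by
  have h : ContDiffAt ℝ 1 (fun q : Ambient n => ‖q.1‖) q := contDiffAt_fst.norm ℝ hq0
  exact ((contDiffAt_const.add h).log (by positivity)).sub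
    ((contDiffAt_const.sub h).log (by linarith))

lemma norm_fderiv_axisDist_le {q : Ambient n} (hq0 : q.1 ≠ 0) (hq : ‖q.1‖ < 1) (v : Ambient n) :
    ‖fderiv ℝ axisDist q v‖ ≤ √(hypProdMetric n q v v) := by
  have hn : HasFDerivAt (fun x : EuclideanSpace ℝ (Fin n) => ‖x‖) _ q.1 :=
    ((contDiffAt_norm ℝ hq0 (n := 1)).differentiableAt one_ne_zero).hasFDerivAt
  have h1 : HasFDerivAt (fun q : Ambient n => ‖q.1‖) _ q := hn.comp q hasFDerivAt_fst
  have hp : (0 : ℝ) ≤ ‖q.1‖ := norm_nonneg _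
  have h2 : HasDerivAt (fun r : ℝ => Real.log (1 + r) - Real.log (1 - r))
      (2 / (1 - ‖q.1‖ ^ 2)) ‖q.1‖ := by
    have h3 := (((hasDerivAt_id ‖q.1‖).const_add 1).log (by simp only [id]; positivity)).fun_sub
      (((hasDerivAt_id ‖q.1‖).const_sub 1).log (by simp only [id]; linarith))
    refine h3.congr_deriv ?_
    simp only [id]
    have e1 : 1 + ‖q.1‖ ≠ 0 := by positivity
    have e2 : 1 - ‖q.1‖ ≠ 0 := by linarith
    have e3 : 1 - ‖q.1‖ ^ 2 ≠ 0 := by nlinarith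
    field_simp
    ring
  have h4 := h2.comp_hasFDerivAt q h1
  have h8 : axisDist = (fun r : ℝ => Real.log (1 + r) - Real.log (1 - r)) ∘
      fun q : Ambient n => ‖q.1‖ := rfl
  rw [h8, h4.fderiv]
  refine le_trans ?_ (conformal_mul_norm_le q v)
  have h5 : ‖fderiv ℝ (fun x : EuclideanSpace ℝ (Fin n) => ‖x‖) q.1‖ ≤ 1 := by
    simpa using norm_fderiv_le_of_lipschitz ℝ (x₀ := q.1)
      (lipschitzWith_one_norm (E := EuclideanSpace ℝ (Fin n)))
  have h6 := (fderiv ℝ (fun x : EuclideanSpace ℝ (Fin n) => ‖x‖) q.1).le_of_opNorm_le h5 v.1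
  rw [one_mul] at h6
  have h7 : 0 ≤ 2 / (1 - ‖q.1‖ ^ 2) := zero_le_one.trans (one_le_conformal hq)
  rw [smul_apply, norm_smul, Real.norm_of_nonneg h7]
  exact mul_le_mul_of_nonneg_left h6 h7

variable [Fact (2 ≤ n)] {I : TopologicalSpace.Opens ℝ} {f : ℝ → ℝ}

/-- A rotation hypersurface away from the axis whose profile is proper is complete: the height, the
position in the ball and the distance to the axis are 1-Lipschitz, so that along a Cauchy sequence
the profile stays bounded and the heights stay in a compact part of `I`. -/
lemma isCompleteFor_rotationParam (hf : ∀ t ∈ I, ContDiffAt ℝ ∞ f t)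
    (hpos : ∀ t ∈ I, 0 < f t)
    (hproper : ∀ C, ∃ K : Set ℝ, IsCompact K ∧ K ⊆ I ∧ ∀ t ∈ I, f t ≤ C → t ∈ K) :
    IsCompleteFor (cylinderModel n) (hypProdMetric n) (rotationParam n I f) := by
  intro u hu
  set X := rotationParam n I f with hXdef
  have hX : ContMDiff (cylinderModel n) 𝓘(ℝ, Ambient n) 1 X :=
    (contMDiff_rotationParam hf).of_le (by simp)
  have hr : ∀ p : I × UnitSphere n, ‖(X p).1‖ = Real.tanh (f p.1 / 2) := fun p => by
    simp [hXdef, rotationParam, norm_smul, abs_of_pos (tanh_half_pos (hpos _ p.1.2))]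
  have hlt : ∀ p, ‖(X p).1‖ < 1 := fun p => by rw [hr]; exact Real.tanh_lt_one _
  have hne : ∀ p, (X p).1 ≠ 0 := fun p => by
    rw [← norm_pos_iff, hr]; exact tanh_half_pos (hpos _ p.1.2)
  have hdist : ∀ p, axisDist (X p) = f p.1 := fun p => by rw [axisDist, hr, log_tanh_half]
  -- a map with derivative bounded by the metric sends `u` to a Cauchy sequence
  have cauchy : ∀ {E : Type} [NormedAddCommGroup E] [NormedSpace ℝ E] [CompleteSpace E]
      (P : Ambient n → E), (∀ p, ContDiffAt ℝ 1 P (X p)) →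
      (∀ p v, ‖fderiv ℝ P (X p) v‖ ≤ √(hypProdMetric n (X p) v v)) →
      ∃ L, Tendsto (fun k => P (X (u k))) atTop (𝓝 L) := by
    intro E _ _ _ P hP hg
    refine cauchySeq_tendsto_of_complete (EMetric.cauchySeq_iff.2 fun ε hε => ?_)
    obtain ⟨N, hN⟩ := hu ε hε
    exact ⟨N, fun k hk l hl => (edist_le_inducedEDist hX hP hg _ _).trans_lt (hN k hk l hl)⟩
  obtain ⟨x, hx⟩ := cauchy Prod.fst (fun _ => contDiffAt_fst) fun p v => by
    rw [fderiv_fst]; exact norm_fst_le_hypProdMetric v (hlt p)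
  obtain ⟨t, ht⟩ := cauchy Prod.snd (fun _ => contDiffAt_snd) fun p v => by
    rw [fderiv_snd]; exact norm_snd_le_hypProdMetric _ v
  obtain ⟨L, hL⟩ := cauchy axisDist (fun p => contDiffAt_axisDist (hne p) (hlt p))
    fun p v => norm_fderiv_axisDist_le (hne p) (hlt p) v
  simp only [hdist] at hL
  have ht' : Tendsto (fun k => ((u k).1 : ℝ)) atTop (𝓝 t) := ht
  obtain ⟨K, hK, hKI, hKf⟩ := hproper (L + 1)
  have htI : t ∈ I := hKI <| hK.isClosed.mem_of_tendsto ht' <| by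
    filter_upwards [hL.eventually_lt_const (lt_add_one L)] with k hk
      using hKf _ (u k).1.2 hk.le
  have hrt : Tendsto (fun k => Real.tanh (f (u k).1 / 2)) atTop (𝓝 (Real.tanh (f t / 2))) :=
    (contDiff_tanh.continuous.tendsto _).comp
      (((hf t htI).continuousAt.tendsto.comp ht').div_const 2)
  have hξ : Tendsto (fun k => ((u k).2 : EuclideanSpace ℝ (Fin n))) atTop
      (𝓝 ((Real.tanh (f t / 2))⁻¹ • x)) := by
    refine ((hrt.inv₀ (tanh_half_pos (hpos t htI)).ne').smul hx).congr fun k => ?_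
    simp only [hXdef, rotationParam]
    rw [inv_smul_smul₀ (tanh_half_pos (hpos _ (u k).1.2)).ne']
  have hmem : (Real.tanh (f t / 2))⁻¹ • x ∈ Metric.sphere (0 : EuclideanSpace ℝ (Fin n)) 1 :=
    Metric.isClosed_sphere.mem_of_tendsto hξ (Eventually.of_forall fun k => (u k).2.2)
  exact ⟨(⟨t, htI⟩, ⟨_, hmem⟩),
    (tendsto_subtype_rng.2 ht').prodMk_nhds (tendsto_subtype_rng.2 hξ)⟩

end Completeness

/-! ### Properties of the maximal solutions -/

noncomputable section Catenoid

variable {n m : ℕ} {a : ℝ} {I : TopologicalSpace.Opens ℝ} {f : ℝ → ℝ}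

lemma monotoneOn_invTime (hm : 0 < m) (ha : 0 < a) : MonotoneOn (invTime m a) (Ici a) := by
  intro x hx y hy hxy
  have hx1 := one_le_sinhRatioPow (m := m) ha hx
  have hy1 := one_le_sinhRatioPow (m := m) ha hy
  have hsa := Real.sinh_pos_iff.2 ha
  have hsx := Real.sinh_pos_iff.2 (ha.trans_le hx)
  refine (strictMono_catTime hm ha).monotone
    ((Real.arcosh_le_arcosh (by linarith) (by linarith)).2 ?_)
  exact pow_le_pow_left₀ (by positivity)
    (div_le_div_of_nonneg_right (Real.sinh_le_sinh.2 hxy) hsa.le) m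

/-- The profile tends to infinity at the ends of the interval. -/
lemma exists_compact_catProfile_le (hm : 0 < m) (ha : 0 < a) (C : ℝ) :
    ∃ K : Set ℝ, IsCompact K ∧ K ⊆ catInterval m a ∧
      ∀ t ∈ catInterval m a, catProfile m a t ≤ C → t ∈ K := by
  have hT := (invTime_mem hm ha (le_max_right C a)).2
  refine ⟨Icc (-invTime m a (max C a)) (invTime m a (max C a)), isCompact_Icc,
    fun t ht => ⟨by linarith [ht.1], by linarith [ht.2]⟩, fun t ht htC => ?_⟩
  have ht' : t ∈ Ioo (-catHalf m a) (catHalf m a) := ht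
  have key : ∀ s ∈ Ico 0 (catHalf m a), catProfile m a s ≤ C → s ≤ invTime m a (max C a) := by
    intro s hs hsC
    rw [← invTime_catProfile hm ha hs]
    exact monotoneOn_invTime hm ha (le_catProfile ha s) (le_max_right C a)
      (hsC.trans (le_max_left C a))
  rcases le_total 0 t with h | h
  · have := key t ⟨h, ht'.2⟩ htC
    exact ⟨by linarith, this⟩
  · have := key (-t) ⟨by linarith, by linarith [ht'.1]⟩ (by rwa [catProfile_neg hm ha ht'])
    exact ⟨by linarith, by linarith⟩

lemma IsMaximalCatenarySolution.contDiffAt (hn : 2 ≤ n) (ha : 0 < a)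
    (h : IsMaximalCatenarySolution n a I f) {t : ℝ} (ht : t ∈ I) : ContDiffAt ℝ ∞ f t := by
  obtain ⟨rfl, hf⟩ := h.eq_catProfile hn ha
  exact (contDiffAt_catProfile (by omega) ha ht).congr_of_eventuallyEq
    (hf.eventuallyEq_of_mem ((catInterval (n - 1) a).isOpen.mem_nhds ht))

lemma IsMaximalCatenarySolution.isCompleteFor [Fact (2 ≤ n)] (hn : 2 ≤ n) (ha : 0 < a)
    (h : IsMaximalCatenarySolution n a I f) :
    IsCompleteFor (cylinderModel n) (hypProdMetric n) (rotationParam n I f) := by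
  refine isCompleteFor_rotationParam (fun t ht => h.contDiffAt hn ha ht) h.pos fun C => ?_
  obtain ⟨rfl, hf⟩ := h.eq_catProfile hn ha
  obtain ⟨K, hK, hKI, hKC⟩ := exists_compact_catProfile_le (m := n - 1) (by omega) ha C
  exact ⟨K, hK, hKI, fun t ht htC => hKC t ht (by rwa [← hf ht])⟩

lemma IsCatenarySolution.hasZeroMeanCurvature [Fact (2 ≤ n)] (h : IsCatenarySolution n a I f) :
    HasZeroMeanCurvature (cylinderModel n) (hypProdMetric n) (rotationParam n I f) := by
  intro p
  rw [extChartAt_cylinder_self]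
  refine (zeroMeanCurvatureAt_rotationLocal p.2 (h.pos _ p.1.2) ?_ (h.ode _ p.1.2)).congr
    (rotationParam_comp_extChartAt_symm p)
  filter_upwards [I.isOpen.mem_nhds p.1.2] with t ht using h.differentiableAt t ht

lemma verticalHeight_rotationParam (hn : 2 ≤ n) :
    verticalHeight (range (rotationParam n I f)) = Metric.ediam (I : Set ℝ) := by
  have : Nontrivial (EuclideanSpace ℝ (Fin n)) :=
    Module.nontrivial_of_finrank_pos (R := ℝ) (by rw [finrank_euclideanSpace_fin]; omega)
  obtain ⟨ξ⟩ : Nonempty (UnitSphere n) :=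
    (NormedSpace.sphere_nonempty.2 zero_le_one).to_subtype
  rw [verticalHeight]
  congr 1
  ext t
  constructor
  · rintro ⟨_, ⟨p, rfl⟩, rfl⟩
    exact p.1.2
  · intro ht
    exact ⟨_, ⟨(⟨t, ht⟩, ξ), rfl⟩, rfl⟩

lemma verticalHeight_catInterval (hn : 2 ≤ n) :
    verticalHeight (range (rotationParam n (catInterval (n - 1) a) f)) =
      ENNReal.ofReal (2 * catHalf (n - 1) a) := by
  rw [verticalHeight_rotationParam hn]
  refine (Real.ediam_Ioo _ _).trans ?_
  congr 1
  ring

lemma IsMaximalCatenarySolution.rotationHeight_eq (hn : 2 ≤ n) (ha : 0 < a)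
    (h : IsMaximalCatenarySolution n a I f) : rotationHeight n I f = 2 * catHalf (n - 1) a := by
  obtain ⟨rfl, -⟩ := h.eq_catProfile hn ha
  have := catHalf_pos (m := n - 1) (by omega) ha
  rw [rotationHeight, verticalHeight_catInterval hn, ENNReal.toReal_ofReal (by positivity)]

lemma generatingCurve_congr {g : ℝ → ℝ} (h : EqOn f g I) :
    generatingCurve I f = generatingCurve I g :=
  image_congr fun t ht => by rw [h ht]

lemma IsMaximalCatenarySolution.generatingCurve_eq (hn : 2 ≤ n) (ha : 0 < a)
    (h : IsMaximalCatenarySolution n a I f) :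
    generatingCurve I f = generatingCurve (catInterval (n - 1) a) (catProfile (n - 1) a) := by
  obtain ⟨rfl, hf⟩ := h.eq_catProfile hn ha
  exact generatingCurve_congr hf

end Catenoid

theorem proposition3p2 (n : ℕ) [Fact (2 ≤ n)] :
    -- for every `a > 0` there is a unique maximal solution
    (∀ a : ℝ, 0 < a → ∃ (I : TopologicalSpace.Opens ℝ) (f : ℝ → ℝ),
      IsMaximalCatenarySolution n a I f ∧
      ∀ (I' : TopologicalSpace.Opens ℝ) (f' : ℝ → ℝ), IsMaximalCatenarySolution n a I' f' →
        I' = I ∧ EqOn f' f I) ∧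
    ∀ (I : ℝ → TopologicalSpace.Opens ℝ) (f : ℝ → ℝ → ℝ),
      (∀ a, 0 < a → IsMaximalCatenarySolution n a (I a) (f a)) →
      -- the catenoid is a complete minimal immersed rotation hypersurface
      (∀ a, 0 < a →
        IsSmoothImmersionInto (cylinderModel n) (hypProd n) (rotationParam n (I a) (f a)) ∧
        HasZeroMeanCurvature (cylinderModel n) (hypProdMetric n) (rotationParam n (I a) (f a)) ∧
        IsCompleteFor (cylinderModel n) (hypProdMetric n) (rotationParam n (I a) (f a))) ∧
      (∃ T : ℝ → ℝ, ∀ a, 0 < a →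
        -- (1)
        0 < T a ∧ (I a : Set ℝ) = Ioo (-T a) (T a) ∧
        (∀ t ∈ I a, f a (-t) = f a t) ∧
        -- (2)
        (∀ t ∈ I a, a ≤ f a t) ∧
        -- (3)
        (∀ t ∈ Ioo 0 (T a), 0 < deriv (f a) t) ∧
        (∀ t ∈ Ioo (-T a) 0, deriv (f a) t < 0) ∧
        -- (4)
        BijOn (f a) (Ico 0 (T a)) (Ici a) ∧
        (∀ ρ, a ≤ ρ → IntervalIntegrable (catenaryIntegrand n a) volume a ρ) ∧
        InvOn (catenaryInverse n a) (f a) (Ico 0 (T a)) (Ici a)) ∧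
      -- (5)
      (∀ a, 0 < a →
        verticalHeight (range (rotationParam n (I a) (f a))) < ⊤ ∧
        IntegrableOn (catenaryIntegrand n a) (Ioi a) ∧
        rotationHeight n (I a) (f a) =
          2 * Real.sinh a ^ (n - 1) * ∫ u in Ioi a, catenaryIntegrand n a u) ∧
      -- (6)
      StrictMonoOn (fun a => rotationHeight n (I a) (f a)) (Ioi 0) ∧
      Tendsto (fun a => rotationHeight n (I a) (f a)) (𝓝[>] 0) (𝓝 0) ∧
      Tendsto (fun a => rotationHeight n (I a) (f a)) atTop (𝓝 (Real.pi / ((n : ℝ) - 1))) ∧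
      (∀ a b, 0 < a → 0 < b → a ≠ b →
        ∃ x t : ℝ, 0 < t ∧
          generatingCurve (I a) (f a) ∩ generatingCurve (I b) (f b) = {(x, t), (x, -t)}) := by
  have hn : 2 ≤ n := Fact.out
  have hm : 0 < n - 1 := by omega
  refine ⟨fun a ha => ⟨_, _, isMaximalCatenarySolution_catProfile hn ha, fun I' f' h => ?_⟩,
    fun I f hsol => ?_⟩
  · obtain ⟨rfl, hf⟩ := h.eq_catProfile hn ha
    exact ⟨rfl, hf⟩
  have hheight : ∀ a, 0 < a → rotationHeight n (I a) (f a) = 2 * catHalf (n - 1) a :=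
    fun a ha => (hsol a ha).rotationHeight_eq hn ha
  refine ⟨fun a ha => ⟨isSmoothImmersionInto_rotationParam
      (fun t ht => (hsol a ha).contDiffAt hn ha ht) (hsol a ha).pos,
      (hsol a ha).hasZeroMeanCurvature, (hsol a ha).isCompleteFor hn ha⟩,
    ⟨catHalf (n - 1), fun a ha => ?_⟩, fun a ha => ⟨?_, integrableOn_catenaryIntegrand hn ha, ?_⟩,
    ?_, ?_, ?_, fun a b ha hb hab => ?_⟩
  · obtain ⟨hI, hf⟩ := (hsol a ha).eq_catProfile hn ha
    have hT := catHalf_pos hm ha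
    rw [hI] at hf ⊢
    have hsub : Ico 0 (catHalf (n - 1) a) ⊆ catInterval (n - 1) a := fun t ht =>
      ⟨by linarith [ht.1], ht.2⟩
    have hderiv : ∀ t ∈ Ioo (-catHalf (n - 1) a) (catHalf (n - 1) a),
        deriv (f a) t = Real.sinh (catParam (n - 1) a t) := fun t ht => by
      rw [(hf.eventuallyEq_of_mem (isOpen_Ioo.mem_nhds ht)).deriv_eq]
      exact (hasDerivAt_catProfile hm ha ht).deriv
    have hinv : InvOn (catenaryInverse n a) (f a) (Ico 0 (catHalf (n - 1) a)) (Ici a) := by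
      refine ⟨fun t ht => ?_, fun ρ hρ => ?_⟩
      · rw [hf (hsub ht), catenaryInverse_eq hn ha (le_catProfile ha t),
          invTime_catProfile hm ha ht]
      · rw [catenaryInverse_eq hn ha hρ, hf (hsub (invTime_mem hm ha hρ)),
          catProfile_invTime hm ha hρ]
    refine ⟨hT, rfl, fun t ht => ?_, fun t ht => ?_, fun t ht => ?_, fun t ht => ?_,
      hinv.bijOn (fun t ht => ?_) (fun ρ hρ => ?_),
      fun ρ hρ => intervalIntegrable_catenaryIntegrand hn ha hρ, hinv⟩
    · have ht' : t ∈ Ioo (-catHalf (n - 1) a) (catHalf (n - 1) a) := ht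
      rw [hf ht, hf (show -t ∈ catInterval (n - 1) a from
        ⟨by linarith [ht'.2], by linarith [ht'.1]⟩), catProfile_neg hm ha ht']
    · rw [hf ht]
      exact le_catProfile ha t
    · rw [hderiv t ⟨by linarith [ht.1], ht.2⟩]
      exact Real.sinh_pos_iff.2 (catParam_pos hm ha ht)
    · have h := catParam_pos hm ha (t := -t) ⟨by linarith [ht.2], by linarith [ht.1]⟩
      have ht' : t ∈ Ioo (-catHalf (n - 1) a) (catHalf (n - 1) a) := ⟨ht.1, by linarith [ht.2]⟩
      rw [catParam_neg hm ha ht'] at h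
      rw [hderiv t ht']
      exact Real.sinh_neg_iff.2 (by linarith)
    · rw [hf (hsub ht)]
      exact le_catProfile ha t
    · rw [catenaryInverse_eq hn ha hρ]
      exact invTime_mem hm ha hρ
  · obtain ⟨hI, -⟩ := (hsol a ha).eq_catProfile hn ha
    rw [hI, verticalHeight_catInterval hn]
    exact ENNReal.ofReal_lt_top
  · rw [hheight a ha, mul_assoc, integral_catenaryIntegrand hn ha]
  · intro a ha b hb hab
    simp only [hheight a ha, hheight b hb]
    linarith [catHalf_strictMonoOn hm ha hb hab]
  · have h := (tendsto_catHalf_zero hm).const_mul 2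
    rw [mul_zero] at h
    refine h.congr' ?_
    filter_upwards [self_mem_nhdsWithin] with a ha using (hheight a ha).symm
  · have h := (tendsto_catHalf_atTop hm).const_mul 2
    rw [Nat.cast_sub (by omega), Nat.cast_one,
      show 2 * (Real.pi / 2 / ((n : ℝ) - 1)) = Real.pi / ((n : ℝ) - 1) by ring] at h
    refine h.congr' ?_
    filter_upwards [eventually_gt_atTop 0] with a ha using (hheight a ha).symm
  · rw [(hsol a ha).generatingCurve_eq hn ha, (hsol b hb).generatingCurve_eq hn hb]
    rcases lt_or_gt_of_ne hab with h | h
    · exact inter_generatingCurve_of_lt hm ha h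
    · rw [inter_comm]
      exact inter_generatingCurve_of_lt hm hb h
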